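/- Let $d\in\{2,3\}$, $s\ge 3$ real, $T>0$ and $M\in\mathbb R$. Then there is a constant $C$, depending only on $d,s,T,M$, with the following property. Let $u:[0,T]\times\mathbb R^d\to\mathbb R^d$ and $p$ be a classical solution of the Euler equations $\partial_t u+(u\cdot\nabla)u=-\nabla p$, $\nabla\cdot u=0$, that is $2\pi$-periodic in every space coordinate ($u$ being $C^1$ on $[0,T]\times\mathbb R^d$ and $p(\cdot,t)$ being $C^1$ for each $t$), with $\int_{[0,2\pi]^d}u(x,0)\,dx=0$. Write $u_k(t)=(2\pi)^{-d}\int_{[0,2\pi]^d}u(x,t)e^{-ik\cdot x}dx$ and $\|u\|_{H^s}^2=(2\pi)^d\sum_{k\in\mathbb Z^d}(1+|k|^2)^s|u_k|^2$. Assume that $u(t)\in H^s(\mathbb T^d)$ for $0\le t\le T$ and that $\|u(t)\|_{H^3(\mathbb T^d)}\le M$ for $0\le t\le T$. Let $n\ge 1$ and $m\ge n$ be integers, $F=\{k\in\mathbb Z^d:|k|_\infty\le n\}$, $G=\{k\in\mathbb Z^d:n<|k|_\infty\le m\}$, and $A_k=I-kk^T/|k|^2$ for $k\ne0$. Let $v(x,t)=\sum_{k\in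 F}v_k(t)e^{ik\cdot x}$ be a solution on $[0,T]$ of the $t$-model, that is, $v_k(t)\in\mathbb C^d$, $v_k(0)=u_k(0)$ for $k\in F$, $v_0\equiv0$, and for $0\ne k\in F$ $$\frac{d}{dt}v_k=-i\Big[\sum_{\substack{p+q=k\\p\in F,\,q\in F}}k\cdot v_p\,A_kv_q+\sum_{\substack{p+q=k\\p\in F,\,q\in G}}k\cdot v_p\,A_k\,t\,g_q+\sum_{\substack{p+q=k\\p\in G,\,q\in F}}k\cdot (t\,g_p)\,A_kv_q\Big],\qquad g_q=-i\sum_{\substack{r+r'=q\\r,r'\in F}}q\cdot v_r\,A_qv_{r'}$$ (where $k\cdot z=\sum_jk_jz_j$). Then for all $0\le t\le T$ $$\|u(t)-v(t)\|_{L^2(\mathbb T^d)}\le\frac{C}{n^{s-1}}\,\sup_{0\le\tau\le T}\|u(\tau)\|_{H^s(\mathbb T^d)}.$$ -/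

import Mathlib

open MeasureTheory Set
open scoped ENNReal NNReal

noncomputable section

namespace TModelEuler

/-- Physical space `ℝ^d`; functions on the torus of length `2π` are `2π`-periodic functions
on it. Velocities take values in the same space. -/
abbrev Space (d : ℕ) : Type := EuclideanSpace ℝ (Fin d)

/-- Complex amplitude vectors. -/
abbrev Amp (d : ℕ) : Type := EuclideanSpace ℂ (Fin d)

/-- Wave vectors. -/
abbrev Wave (d : ℕ) : Type := Fin d → ℤ

/-- The period cell `[0, 2π]^d`. -/
def cell (d : ℕ) : Set (Space d) := {x | ∀ i, x i ∈ Icc (0 : ℝ) (2 * Real.pi)}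

/-- `2π`-periodicity in every coordinate. -/
def IsPeriodic {d : ℕ} {α : Type*} (f : Space d → α) : Prop :=
  ∀ x : Space d, ∀ j : Fin d, f (x + EuclideanSpace.single j (2 * Real.pi)) = f x

/-- `k · x`. -/
def phase {d : ℕ} (k : Wave d) (x : Space d) : ℝ := ∑ i, (k i : ℝ) * x i

/-- A real vector, seen as a complex one. -/
def toAmp {d : ℕ} (y : Space d) : Amp d := WithLp.toLp 2 fun i => ((y i : ℝ) : ℂ)

/-- The Fourier coefficient `(2π)^{-d} ∫_{[0,2π]^d} f(x) e^{-i k·x} dx`. -/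
def fourierCoef {d : ℕ} (f : Space d → Space d) (k : Wave d) : Amp d :=
  (((2 * Real.pi) ^ d)⁻¹ : ℝ) •
    ∫ x in cell d, Complex.exp (-(Complex.I * (phase k x : ℂ))) • toAmp (f x)

/-- `|k|²`, the squared Euclidean length. -/
def waveSq {d : ℕ} (k : Wave d) : ℝ := ∑ i, (k i : ℝ) ^ 2

/-- The `L²` norm over the torus of a vector field. -/
def l2Norm {d : ℕ} (f : Space d → Amp d) : ℝ≥0∞ := eLpNorm f 2 (volume.restrict (cell d))

/-- The Sobolev norm `‖f‖_{H^s} = ((2π)^d ∑_k (1+|k|²)^s |f_k|²)^{1/2}`, possibly infinite. -/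
def sobolevNorm {d : ℕ} (s : ℝ) (f : Space d → Space d) : ℝ≥0∞ :=
  (ENNReal.ofReal ((2 * Real.pi) ^ d) *
    ∑' k : Wave d, ENNReal.ofReal ((1 + waveSq k) ^ s) * ‖fourierCoef f k‖ₑ ^ 2) ^ (1 / 2 : ℝ)

/-- Membership in `H^s(𝕋^d)`, for `s ≥ 0`. -/
def MemSobolev {d : ℕ} (s : ℝ) (f : Space d → Space d) : Prop :=
  IsPeriodic f ∧ MemLp f 2 (volume.restrict (cell d)) ∧ sobolevNorm s f < ∞

/-- The divergence `∑_j ∂_j f^j`. -/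
def divergence {d : ℕ} (f : Space d → Space d) (x : Space d) : ℝ :=
  ∑ j, (fderiv ℝ f x (EuclideanSpace.single j 1)) j

/-- `(u, p)` is a classical `2π`-periodic solution on `[0, T]` of the Euler equations
`∂_t u + (u·∇)u = -∇p`, `∇·u = 0`, with `∫ u = 0` initially. At `t = 0` and `t = T` the time
derivative is one-sided; `(u·∇)u` at `x` is the derivative of `u(t)` in the direction `u(t,x)`. -/
structure IsEulerSolution {d : ℕ} (T : ℝ) (u : ℝ → Space d → Space d) (p : ℝ → Space d → ℝ) :
    Prop where
  periodic : ∀ t ∈ Icc 0 T, IsPeriodic (u t)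
  periodic_pressure : ∀ t ∈ Icc 0 T, IsPeriodic (p t)
  contDiffOn : ContDiffOn ℝ 1 (fun z : ℝ × Space d => u z.1 z.2) (Icc 0 T ×ˢ univ)
  contDiff_pressure : ∀ t ∈ Icc 0 T, ContDiff ℝ 1 (p t)
  momentum : ∀ t ∈ Icc 0 T, ∀ x,
    derivWithin (fun τ => u τ x) (Icc 0 T) t + fderiv ℝ (u t) x (u t x) = -gradient (p t) x
  incompressible : ∀ t ∈ Icc 0 T, ∀ x, divergence (u t) x = 0
  mean_zero : ∫ x in cell d, u 0 x = 0

/-- The modes `|k|_∞ ≤ n`. -/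
def modes (d n : ℕ) : Finset (Wave d) :=
  Finset.Icc (fun _ => -(n : ℤ)) (fun _ => (n : ℤ))

/-- The resolved modes are `modes d n`; the unresolved modes are `n < |k|_∞ ≤ m`. -/
def unresolved (d n m : ℕ) : Finset (Wave d) := modes d m \ modes d n

/-- `k · z`, bilinear (no complex conjugation). -/
def waveDot {d : ℕ} (k : Wave d) (z : Amp d) : ℂ := ∑ i, (k i : ℂ) * z i

/-- `A_k z = (I - k kᵀ / |k|²) z`; used for `k ≠ 0` only. -/
def proj {d : ℕ} (k : Wave d) (z : Amp d) : Amp d :=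
  WithLp.toLp 2 fun i => z i - (k i : ℂ) * waveDot k z / (waveSq k : ℂ)

/-- `-i ∑_{p+q=k, p ∈ P, q ∈ Q} (k · a_p) A_k b_q`. -/
def interaction {d : ℕ} (P Q : Finset (Wave d)) (a b : Wave d → Amp d) (k : Wave d) : Amp d :=
  (-Complex.I) • ∑ r ∈ P ×ˢ Q with r.1 + r.2 = k, waveDot k (a r.1) • proj k (b r.2)

/-- Right-hand side at time `t` of the `t`-model with resolved modes `F = {|k|_∞ ≤ n}` and
unresolved modes `G = {n < |k|_∞ ≤ m}`. -/
def tModelField {d : ℕ} (n m : ℕ) (t : ℝ) (a : Wave d → Amp d) (k : Wave d) : Amp d :=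
  let F := modes d n
  let G := unresolved d n m
  let g := fun q => (t : ℂ) • interaction F F a a q
  interaction F F a a k + interaction F G a g k + interaction G F g a k

/-- `v` solves the `t`-model on `[0, T]` with initial amplitudes `a`. Only `v t k` with
`|k|_∞ ≤ n` matter. -/
structure IsTModelSolution {d : ℕ} (n m : ℕ) (T : ℝ) (a : Wave d → Amp d)
    (v : ℝ → Wave d → Amp d) : Prop where
  initial : ∀ k ∈ modes d n, v 0 k = a k
  zero_mode : ∀ t ∈ Icc 0 T, v t 0 = 0
  evolution : ∀ t ∈ Icc 0 T, ∀ k ∈ modes d n, k ≠ 0 →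
    HasDerivWithinAt (fun τ => v τ k) (tModelField n m t (v t) k) (Icc 0 T) t

/-- The trigonometric polynomial `∑_{|k|_∞ ≤ n} a_k e^{i k·x}`. -/
def trigPoly {d : ℕ} (n : ℕ) (a : Wave d → Amp d) (x : Space d) : Amp d :=
  ∑ k ∈ modes d n, Complex.exp (Complex.I * (phase k x : ℂ)) • a k

end TModelEuler

end

/-!
In Fourier variables the Euler nonlinearity restricted to any finite set of modes is antisymmetric
in its last two arguments, as long as the fields are solenoidal and real. For the error `w - v`
between the resolved part `w` of `u` and the `t`-model `v`, this antisymmetry turns the memory term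
into `-t ‖y‖² + O(t ‖y‖)`, where `y` is the unresolved part of the nonlinearity of `v`. The negative
square absorbs everything involving `y`, whatever the size of `v`, and the energy inequality only
sees `∑ |k| |u_k|`, which is finite by Sobolev embedding, and two residuals of the exact solution.

Each residual is a convolution over pairs `p + q = k` in which at least one mode exceeds `n / 2`:
either `p` or `q` lies outside `modes d n`, or `|k|_∞ > n`. Incompressibility lets the derivative
fall on either factor, so Young's inequality bounds the residual in `ℓ²` by `∑ |k| |u_k|` times the
`ℓ²` norm of `|k| |u_k|` over `|k|_∞ > n / 2`, which is `O(n^{1-s}) ‖u‖_{H^s}`. Grönwall's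
inequality and Parseval's identity conclude.
-/

namespace TModelEuler

variable {d : ℕ}

section Cell

lemma cell_eq_preimage (d : ℕ) :
    cell d = (WithLp.ofLp : Space d → (Fin d → ℝ)) ⁻¹' Icc 0 (fun _ => 2 * Real.pi) := by
  ext x
  simp [cell, Pi.le_def, forall_and]

lemma isCompact_cell (d : ℕ) : IsCompact (cell d) := by
  rw [cell_eq_preimage]
  exact (PiLp.homeomorph 2 (fun _ : Fin d => ℝ)).isCompact_preimage.2 isCompact_Icc

lemma measurableSet_cell (d : ℕ) : MeasurableSet (cell d) :=
  (isCompact_cell d).isClosed.measurableSet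

instance isFiniteMeasure_restrict_cell (d : ℕ) : IsFiniteMeasure (volume.restrict (cell d)) :=
  ⟨by simpa using (isCompact_cell d).measure_lt_top⟩

lemma integrable_cell {E : Type*} [NormedAddCommGroup E] {f : Space d → E} (hf : Continuous f) :
    Integrable f (volume.restrict (cell d)) :=
  hf.continuousOn.integrableOn_compact (isCompact_cell d)

lemma setIntegral_cell {E : Type*} [NormedAddCommGroup E] [NormedSpace ℝ E] (f : Space d → E) :
    ∫ x in cell d, f x =
      ∫ y in Icc (0 : Fin d → ℝ) (fun _ => 2 * Real.pi), f (WithLp.toLp 2 y) := by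
  rw [cell_eq_preimage]
  exact ((PiLp.volume_preserving_ofLp (Fin d)).setIntegral_preimage_emb
    (MeasurableEquiv.toLp 2 (Fin d → ℝ)).symm.measurableEmbedding
    (fun y => f (WithLp.toLp 2 y)) _)

end Cell

section Periodic

lemma IsPeriodic.comp {α β : Type*} {f : Space d → α} (hf : IsPeriodic f) (g : α → β) :
    IsPeriodic fun x => g (f x) := fun x j => congrArg g (hf x j)

lemma IsPeriodic.add_toLp {α : Type*} {f : Space d → α} (hf : IsPeriodic f) (k : Wave d)
    (x : Space d) : f (x + WithLp.toLp 2 (fun i => 2 * Real.pi * k i)) = f x := by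
  have periodic_sum : Function.Periodic f
      (∑ j, k j • (EuclideanSpace.single j (2 * Real.pi) : Space d)) :=
    Finset.sum_induction _ (Function.Periodic f) (fun a b ha hb => ha.add_period hb)
      (by simp [Function.Periodic]) fun j _ => Function.Periodic.zsmul (fun x => hf x j) (k j)
  have shift_eq : (WithLp.toLp 2 (fun i => 2 * Real.pi * k i) : Space d) =
      ∑ j, k j • (EuclideanSpace.single j (2 * Real.pi) : Space d) := by
    ext i
    simp [Finset.sum_apply, Pi.single_apply, mul_comm]
  rw [shift_eq]
  exact periodic_sum x

end Periodic

section Character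

lemma phase_add (k l : Wave d) (x : Space d) : phase (k + l) x = phase k x + phase l x := by
  simp [phase, add_mul, Finset.sum_add_distrib]

lemma phase_neg (k : Wave d) (x : Space d) : phase (-k) x = -phase k x := by
  simp [phase]

/-- `phase k` as a linear functional. -/
noncomputable def phaseCLM (k : Wave d) : Space d →L[ℝ] ℝ :=
  ∑ i, (k i : ℝ) • EuclideanSpace.proj i

lemma phaseCLM_apply (k : Wave d) (x : Space d) : phaseCLM k x = phase k x := by
  simp [phaseCLM, phase]

lemma coe_phaseCLM (k : Wave d) : ⇑(phaseCLM k) = phase k := funext (phaseCLM_apply k)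

lemma phaseCLM_single (k : Wave d) (j : Fin d) (r : ℝ) :
    phaseCLM k (EuclideanSpace.single j r) = k j * r := by
  simp [phaseCLM_apply, phase]

/-- The character `e^{i k·x}` of the torus. -/
noncomputable def character (k : Wave d) (x : Space d) : ℂ :=
  Complex.exp (Complex.I * (phase k x : ℂ))

lemma character_add (k l : Wave d) (x : Space d) :
    character (k + l) x = character k x * character l x := by
  simp [character, phase_add, mul_add, Complex.exp_add]

lemma norm_character (k : Wave d) (x : Space d) : ‖character k x‖ = 1 := by
  rw [character, mul_comm, Complex.norm_exp_ofReal_mul_I]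

lemma isPeriodic_character (k : Wave d) : IsPeriodic (character k) := by
  intro x j
  have shift : Complex.I * (phase k (x + EuclideanSpace.single j (2 * Real.pi)) : ℂ) =
      Complex.I * (phase k x : ℂ) + (k j : ℂ) * (2 * Real.pi * Complex.I) := by
    rw [← phaseCLM_apply, map_add, phaseCLM_single, phaseCLM_apply]
    push_cast
    ring
  rw [character, shift, Complex.exp_add, Complex.exp_int_mul_two_pi_mul_I, mul_one, character]

lemma hasFDerivAt_character (k : Wave d) (x : Space d) :
    HasFDerivAt (character k)
      (character k x • Complex.I • Complex.ofRealCLM.comp (phaseCLM k)) x := by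
  have hphase : HasFDerivAt (fun x => (phase k x : ℂ)) (Complex.ofRealCLM.comp (phaseCLM k)) x := by
    simp only [← phaseCLM_apply]
    exact Complex.ofRealCLM.hasFDerivAt.comp x (phaseCLM k).hasFDerivAt
  exact (hphase.const_mul Complex.I).cexp

lemma contDiff_character (k : Wave d) : ContDiff ℝ 1 (character k) := by
  have hphase : ContDiff ℝ 1 (phase k) := coe_phaseCLM k ▸ (phaseCLM k).contDiff
  exact (contDiff_const.mul (Complex.ofRealCLM.contDiff.comp hphase)).cexp

lemma continuous_character (k : Wave d) : Continuous (character k) :=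
  (contDiff_character k).continuous

end Character

section Torus

/-- The function on the unit torus to which a `2π`-periodic function descends; it brings Mathlib's
Fourier analysis on `UnitAddTorus` to bear on periodic functions. It evaluates the function at the
representative in `(0, 2π]^d`. -/
noncomputable def torusFun {α : Type*} (f : Space d → α) (θ : UnitAddTorus (Fin d)) : α :=
  f (WithLp.toLp 2 fun i => 2 * Real.pi * (AddCircle.equivIoc 1 0 (θ i)).1)

lemma IsPeriodic.torusFun_coe {α : Type*} {f : Space d → α} (hf : IsPeriodic f) (y : Fin d → ℝ) :
    torusFun f (fun i => (y i : UnitAddCircle)) =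
      f (WithLp.toLp 2 fun i => 2 * Real.pi * y i) := by
  have representative_eq : ∀ i, ∃ k : ℤ,
      y i + k = (AddCircle.equivIoc 1 0 ((y i : ℝ) : UnitAddCircle)).1 := by
    intro i
    have hcoe := AddCircle.coe_equivIoc (p := (1 : ℝ)) (a := 0) (y := ((y i : ℝ) : UnitAddCircle))
    obtain ⟨m, hm⟩ := (AddCircle.coe_eq_zero_iff 1).1
      (show (((AddCircle.equivIoc 1 0 ((y i : ℝ) : UnitAddCircle)).1 - y i : ℝ) :
        UnitAddCircle) = 0 by rw [AddCircle.coe_sub, hcoe, sub_self])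
    exact ⟨m, by rw [zsmul_one] at hm; linarith⟩
  choose k hk using representative_eq
  rw [torusFun, ← hf.add_toLp k (WithLp.toLp 2 fun i => 2 * Real.pi * y i)]
  congr 1
  ext i
  simp [← hk, mul_add]

lemma IsPeriodic.continuous_torusFun {X : Type*} [TopologicalSpace X] {f : Space d → X}
    (hf : IsPeriodic f) (hc : Continuous f) :
    Continuous (torusFun f) := by
  have hquot : IsOpenQuotientMap (Pi.map fun (_ : Fin d) (y : ℝ) => (y : UnitAddCircle)) :=
    IsOpenQuotientMap.piMap fun _ => QuotientAddGroup.isOpenQuotientMap_mk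
  rw [hquot.isQuotientMap.continuous_iff]
  have hlift : torusFun f ∘ Pi.map (fun (_ : Fin d) (y : ℝ) => (y : UnitAddCircle)) =
      fun y => f (WithLp.toLp 2 fun i => 2 * Real.pi * y i) := funext hf.torusFun_coe
  rw [hlift]
  fun_prop

lemma mFourier_coe (k : Wave d) (y : Fin d → ℝ) :
    UnitAddTorus.mFourier k (fun i => (y i : UnitAddCircle)) =
      character k (WithLp.toLp 2 fun i => 2 * Real.pi * y i) := by
  simp only [UnitAddTorus.mFourier, ContinuousMap.coe_mk, fourier_coe_apply, character, phase,
    ← Complex.exp_sum]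
  congr 1
  push_cast
  rw [Finset.mul_sum]
  refine Finset.sum_congr rfl fun i _ => ?_
  ring_nf

lemma torusFun_character (k : Wave d) : torusFun (character k) = UnitAddTorus.mFourier k := by
  ext θ
  have hθ : (fun i => ((AddCircle.equivIoc 1 0 (θ i)).1 : UnitAddCircle)) = θ :=
    funext fun _ => AddCircle.coe_equivIoc
  conv_rhs => rw [← hθ, mFourier_coe]
  rfl

end Torus

section Coefficients

variable {E F : Type*} [NormedAddCommGroup E] [NormedSpace ℂ E] [NormedAddCommGroup F]
  [NormedSpace ℂ F]

/-- The Fourier coefficient `(2π)^{-d} ∫_{[0,2π]^d} f(x) e^{-i k·x} dx` of a function with values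
in a complex normed space. -/
noncomputable def coef (f : Space d → E) (k : Wave d) : E :=
  (((2 * Real.pi) ^ d)⁻¹ : ℝ) • ∫ x in cell d, character (-k) x • f x

lemma integrable_character_smul {f : Space d → E} (hf : Continuous f) (k : Wave d) :
    Integrable (fun x => character k x • f x) (volume.restrict (cell d)) :=
  integrable_cell ((continuous_character k).smul hf)

lemma coef_sub {f g : Space d → E} (hf : Continuous f) (hg : Continuous g) (k : Wave d) :
    coef (fun x => f x - g x) k = coef f k - coef g k := by
  simp only [coef, smul_sub]
  rw [integral_sub (integrable_character_smul hf _) (integrable_character_smul hg _), smul_sub]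

lemma coef_sum {ι : Type*} (s : Finset ι) {f : ι → Space d → E} (hf : ∀ i ∈ s, Continuous (f i))
    (k : Wave d) : coef (fun x => ∑ i ∈ s, f i x) k = ∑ i ∈ s, coef (f i) k := by
  simp only [coef, Finset.smul_sum]
  rw [integral_finsetSum s fun i hi => integrable_character_smul (hf i hi) _, Finset.smul_sum]

lemma coef_clm_comp [CompleteSpace E] [CompleteSpace F] (L : E →L[ℂ] F) {f : Space d → E}
    (hf : Continuous f) (k : Wave d) : coef (fun x => L (f x)) k = L (coef f k) := by
  simp only [coef, ← map_smul]
  rw [L.integral_comp_comm (integrable_character_smul hf _), L.map_smul_of_tower]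

end Coefficients

section Parseval

/-- The normalised Haar measure, with which Mathlib develops Fourier series on `UnitAddTorus`. -/
noncomputable local instance : MeasureSpace UnitAddCircle := ⟨AddCircle.haarAddCircle⟩

local instance : IsProbabilityMeasure (volume : Measure UnitAddCircle) :=
  inferInstanceAs (IsProbabilityMeasure AddCircle.haarAddCircle)

open scoped Pointwise in
lemma IsPeriodic.integral_torusFun {E : Type*} [NormedAddCommGroup E] [NormedSpace ℝ E]
    {f : Space d → E} (hf : IsPeriodic f) :
    ∫ θ, torusFun f θ = (((2 * Real.pi) ^ d)⁻¹ : ℝ) • ∫ x in cell d, f x := by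
  have hpi : (0 : ℝ) < 2 * Real.pi := by positivity
  have hcube : (2 * Real.pi) • {x : Fin d → ℝ | ∀ i, x i ∈ Ioc ((0 : Fin d → ℝ) i)
      ((0 : Fin d → ℝ) i + 1)} = Set.pi univ fun i => Ioc ((0 : Fin d → ℝ) i) (2 * Real.pi) := by
    ext y
    rw [Set.mem_smul_set_iff_inv_smul_mem₀ hpi.ne']
    simp only [Set.mem_ofPred_eq, Pi.smul_apply, smul_eq_mul, mem_pi, mem_univ, true_imp_iff,
      mem_Ioc, Pi.zero_apply, zero_add]
    refine forall_congr' fun i => ?_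
    rw [inv_mul_le_iff₀ hpi, mul_one, mul_pos_iff_of_pos_left (inv_pos.2 hpi)]
  have hscale := Measure.setIntegral_comp_smul (volume : Measure (Fin d → ℝ))
    (fun y => f (WithLp.toLp 2 y))
    {x | ∀ i, x i ∈ Ioc ((0 : Fin d → ℝ) i) ((0 : Fin d → ℝ) i + 1)} hpi.ne'
  rw [hcube, Module.finrank_fin_fun, abs_of_pos (by positivity), volume_pi,
    setIntegral_congr_set Measure.univ_pi_Ioc_ae_eq_Icc] at hscale
  refine (UnitAddTorus.integral_preimage _ 0).trans ?_
  simp only [hf.torusFun_coe]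
  rw [setIntegral_cell]
  exact hscale

lemma mFourierCoeff_torusFun {E : Type*} [NormedAddCommGroup E] [NormedSpace ℂ E]
    {f : Space d → E} (hf : IsPeriodic f) (k : Wave d) :
    UnitAddTorus.mFourierCoeff (torusFun f) k = coef f k := by
  have hper : IsPeriodic fun x => character (-k) x • f x := fun x j => by
    simp only [isPeriodic_character (-k) x j, hf x j]
  rw [coef, ← hper.integral_torusFun, UnitAddTorus.mFourierCoeff, ← torusFun_character]
  rfl

lemma coef_character (k l : Wave d) : coef (character l) k = if k = l then 1 else 0 := by
  have hrepr := congrArg (fun a => a k)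
    ((UnitAddTorus.mFourierBasis (d := Fin d)).repr_self l)
  simp only [UnitAddTorus.mFourierBasis_repr, UnitAddTorus.coe_mFourierBasis,
    UnitAddTorus.mFourierLp, UnitAddTorus.mFourierCoeff_toLp, lp.single_apply,
    Pi.single_apply] at hrepr
  rw [← mFourierCoeff_torusFun (isPeriodic_character l), torusFun_character, hrepr]

lemma hasSum_coef_mul_character {f : Space d → ℂ} (hf : IsPeriodic f) (hc : Continuous f)
    (hs : Summable (coef f)) (x : Space d) :
    HasSum (fun k => coef f k * character k x) (f x) := by
  let f' : C(UnitAddTorus (Fin d), ℂ) := ⟨torusFun f, hf.continuous_torusFun hc⟩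
  have hcoeff : UnitAddTorus.mFourierCoeff f' = coef f := funext (mFourierCoeff_torusFun hf)
  have hrescale : (WithLp.toLp 2 fun i => 2 * Real.pi * (x i / (2 * Real.pi)) : Space d) = x := by
    ext i
    simp [mul_div_cancel₀]
  have hseries := UnitAddTorus.hasSum_mFourier_series_apply_of_summable (hcoeff ▸ hs)
    fun i => ((x i / (2 * Real.pi) : ℝ) : UnitAddCircle)
  rw [hcoeff] at hseries
  simpa only [f', ContinuousMap.coe_mk, hf.torusFun_coe, mFourier_coe, hrescale, smul_eq_mul]
    using hseries

lemma hasSum_norm_sq_coef {f : Space d → ℂ} (hf : IsPeriodic f) (hc : Continuous f) :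
    HasSum (fun k => ‖coef f k‖ ^ 2) (((2 * Real.pi) ^ d)⁻¹ * ∫ x in cell d, ‖f x‖ ^ 2) := by
  let f' : C(UnitAddTorus (Fin d), ℂ) := ⟨torusFun f, hf.continuous_torusFun hc⟩
  have hparseval := UnitAddTorus.hasSum_sq_mFourierCoeff (f'.toLp 2 volume ℂ)
  have hae : ∫ θ, ‖f'.toLp 2 volume ℂ θ‖ ^ 2 = ∫ θ, torusFun (fun x => ‖f x‖ ^ 2) θ :=
    integral_congr_ae ((ContinuousMap.coeFn_toLp (p := 2) (𝕜 := ℂ) volume f').mono fun θ hθ => by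
      simp only [hθ]; rfl)
  rw [hae, (hf.comp fun z => ‖z‖ ^ 2).integral_torusFun, smul_eq_mul] at hparseval
  simpa only [UnitAddTorus.mFourierCoeff_toLp, f', ContinuousMap.coe_mk,
    mFourierCoeff_torusFun hf] using hparseval

lemma hasSum_norm_sq_coef_amp {f : Space d → Amp d} (hf : IsPeriodic f) (hc : Continuous f) :
    HasSum (fun k => ‖coef f k‖ ^ 2) (((2 * Real.pi) ^ d)⁻¹ * ∫ x in cell d, ‖f x‖ ^ 2) := by
  have hcoord (j : Fin d) : Continuous fun x => f x j := by fun_prop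
  have hsum := hasSum_sum (s := Finset.univ) fun j _ =>
    hasSum_norm_sq_coef (hf.comp fun z : Amp d => z j) (hcoord j)
  rw [← Finset.mul_sum, ← integral_finsetSum _ fun j _ =>
    integrable_cell (f := fun x => ‖f x j‖ ^ 2) ((hcoord j).norm.pow 2)] at hsum
  simp only [EuclideanSpace.norm_sq_eq]
  convert! hsum using 5 with k j
  exact (coef_clm_comp (EuclideanSpace.proj j : Amp d →L[ℂ] ℂ) hc k).symm

end Parseval

section Product

variable {E : Type*} [NormedAddCommGroup E] [NormedSpace ℂ E]

lemma hasSum_coef_smul {f : Space d → ℂ} {g : Space d → E} (hf : IsPeriodic f)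
    (hc : Continuous f) (hs : Summable fun k => ‖coef f k‖) (hg : Continuous g) (k : Wave d) :
    HasSum (fun p => coef f p • coef g (k - p)) (coef (fun x => f x • g x) k) := by
  have hint (p : Wave d) : Integrable (fun x => coef f p • character (-(k - p)) x • g x)
      (volume.restrict (cell d)) := (integrable_character_smul hg _).smul _
  have hnorm : Summable fun p => ∫ x in cell d, ‖coef f p • character (-(k - p)) x • g x‖ := by
    simp only [norm_smul, norm_character, one_mul, integral_const_mul]
    exact hs.mul_right _
  have hseries (x : Space d) : ∑' p, coef f p • character (-(k - p)) x • g x =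
      character (-k) x • f x • g x := by
    have hinv := (hasSum_coef_mul_character hf hc hs.of_norm x).smul_const
      (character (-k) x • g x)
    rw [smul_comm, ← hinv.tsum_eq]
    refine tsum_congr fun p => ?_
    rw [neg_sub, sub_eq_add_neg, character_add, mul_smul, mul_smul]
  have hsum := (hasSum_integral_of_summable_integral_norm hint hnorm).const_smul
    (((2 * Real.pi) ^ d)⁻¹ : ℝ)
  simp only [hseries, integral_smul, smul_comm _ (coef f _)] at hsum
  exact hsum

end Product

section Derivative

variable {E : Type*}

lemma IsPeriodic.toLp_insertNth {n : ℕ} {f : Space (n + 1) → E} (hf : IsPeriodic f)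
    (j : Fin (n + 1)) (x : Fin n → ℝ) :
    f (WithLp.toLp 2 (j.insertNth (2 * Real.pi) x)) = f (WithLp.toLp 2 (j.insertNth 0 x)) := by
  rw [← hf (WithLp.toLp 2 (j.insertNth 0 x)) j]
  congr 1
  ext l
  refine Fin.succAboveCases j ?_ (fun m => ?_) l
  · simp
  · simp [Fin.succAbove_ne]

lemma integral_cell_fderiv [NormedAddCommGroup E] [NormedSpace ℝ E] {f : Space d → E}
    (hf : IsPeriodic f) (hc : ContDiff ℝ 1 f) (j : Fin d) :
    ∫ x in cell d, fderiv ℝ f x (EuclideanSpace.single j 1) = 0 := by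
  obtain _ | n := d
  · exact j.elim0
  rw [setIntegral_cell]
  let e : (Fin (n + 1) → ℝ) ≃L[ℝ] Space (n + 1) :=
    (PiLp.continuousLinearEquiv 2 ℝ (fun _ : Fin (n + 1) => ℝ)).symm
  let c : Fin (n + 1) → ℝ := Pi.single j 1
  have hderiv (i y) : HasFDerivAt (fun y => c i • f (e y))
      (c i • (fderiv ℝ f (e y)).comp e.toContinuousLinearMap) y :=
    ((hc.differentiable one_ne_zero (e y)).hasFDerivAt.comp y e.hasFDerivAt).const_smul (c i)
  have hdiv (y) : ∑ i, (c i • (fderiv ℝ f (e y)).comp e.toContinuousLinearMap) (Pi.single i 1) =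
      fderiv ℝ f (WithLp.toLp 2 y) (EuclideanSpace.single j 1) := by
    rw [Finset.sum_eq_single j (fun i _ hi => by simp [c, hi]) (by simp)]
    simp [c, e]
  have hint : IntegrableOn
      (fun y => ∑ i, (c i • (fderiv ℝ f (e y)).comp e.toContinuousLinearMap) (Pi.single i 1))
      (Icc 0 fun _ => 2 * Real.pi) := by
    simp only [hdiv]
    exact (((hc.continuous_fderiv one_ne_zero).comp e.continuous).clm_apply
      continuous_const).continuousOn.integrableOn_compact isCompact_Icc
  have hgauss := integral_divergence_of_hasFDerivAt_off_countable' 0 (fun _ => 2 * Real.pi)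
    (fun _ => by simp [Real.pi_pos.le]) (fun i y => c i • f (e y)) _ ∅ countable_empty
    (fun i => (continuous_iff_continuousAt.2 fun y =>
      (hderiv i y).continuousAt).continuousOn) (fun y _ i => hderiv i y) hint
  simp only [hdiv] at hgauss
  rw [hgauss]
  refine Finset.sum_eq_zero fun i _ => sub_eq_zero.2 ?_
  by_cases h : i = j
  · subst h
    exact integral_congr_ae (Filter.Eventually.of_forall fun x =>
      congrArg (c i • ·) (hf.toLp_insertNth i x))
  · simp [c, h]

lemma coef_fderiv [NormedAddCommGroup E] [NormedSpace ℂ E] {f : Space d → E}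
    (hf : IsPeriodic f) (hc : ContDiff ℝ 1 f) (j : Fin d) (k : Wave d) :
    coef (fun x => fderiv ℝ f x (EuclideanSpace.single j 1)) k =
      (Complex.I * k j) • coef f k := by
  have hper : IsPeriodic fun x => character (-k) x • f x := fun x l => by
    simp only [isPeriodic_character (-k) x l, hf x l]
  have hleibniz (x : Space d) :
      fderiv ℝ (fun x => character (-k) x • f x) x (EuclideanSpace.single j 1) =
        character (-k) x • fderiv ℝ f x (EuclideanSpace.single j 1) -
          (Complex.I * k j) • character (-k) x • f x := by
    rw [((hasFDerivAt_character (-k) x).fun_smul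
      (hc.differentiable one_ne_zero x).hasFDerivAt).fderiv]
    simp [phaseCLM_single, smul_smul, sub_eq_add_neg]
    ring_nf
  have hmean := integral_cell_fderiv hper ((contDiff_character (-k)).smul hc) j
  simp only [hleibniz] at hmean
  rw [integral_sub, sub_eq_zero, integral_smul] at hmean
  · rw [coef, hmean, coef, smul_comm]
  · exact integrable_character_smul
      ((hc.continuous_fderiv one_ne_zero).clm_apply continuous_const) _
  · exact (integrable_character_smul hc.continuous _).smul _

end Derivative

section Leray

lemma waveSq_nonneg (k : Wave d) : 0 ≤ waveSq k := Finset.sum_nonneg fun _ _ => sq_nonneg _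

/-- The wave vector `k`, as a complex amplitude. -/
noncomputable def waveVec (k : Wave d) : Amp d := WithLp.toLp 2 fun i => (k i : ℂ)

lemma waveVec_add (k l : Wave d) : waveVec (k + l) = waveVec k + waveVec l := by
  ext i; simp [waveVec]

lemma waveVec_neg (k : Wave d) : waveVec (-k) = -waveVec k := by
  ext i; simp [waveVec]

lemma norm_waveVec (k : Wave d) : ‖waveVec k‖ = √(waveSq k) := by
  simp [waveVec, EuclideanSpace.norm_eq, waveSq]

/-- `z ↦ k · z` as a continuous linear functional. -/
noncomputable def waveDotCLM (k : Wave d) : Amp d →L[ℂ] ℂ := innerSL ℂ (waveVec k)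

lemma coe_waveDotCLM (k : Wave d) : ⇑(waveDotCLM k) = waveDot k := by
  ext z
  simp [waveDotCLM, waveDot, waveVec, PiLp.inner_apply, mul_comm]

lemma waveDot_eq_inner (k : Wave d) (z : Amp d) : waveDot k z = inner ℂ (waveVec k) z := by
  rw [← coe_waveDotCLM, waveDotCLM, innerSL_apply_apply]

lemma waveDot_add_left (k l : Wave d) (z : Amp d) :
    waveDot (k + l) z = waveDot k z + waveDot l z := by
  simp only [waveDot_eq_inner, waveVec_add, inner_add_left]

lemma waveDot_neg_left (k : Wave d) (z : Amp d) : waveDot (-k) z = -waveDot k z := by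
  simp only [waveDot_eq_inner, waveVec_neg, inner_neg_left]

lemma waveDot_zero_left (z : Amp d) : waveDot 0 z = 0 := by simp [waveDot]

lemma norm_waveDot_le (k : Wave d) (z : Amp d) : ‖waveDot k z‖ ≤ √(waveSq k) * ‖z‖ := by
  rw [waveDot_eq_inner, ← norm_waveVec]
  exact norm_inner_le_norm _ _

/-- `A_k`, the orthogonal projection onto the amplitudes transversal to `k`, as a continuous linear
map. At `k = 0` it is the identity, as is `proj 0` through `x / 0 = 0`. -/
noncomputable def projCLM (k : Wave d) : Amp d →L[ℂ] Amp d := (ℂ ∙ waveVec k)ᗮ.starProjection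

lemma coe_projCLM (k : Wave d) : ⇑(projCLM k) = proj k := by
  ext z i
  rw [projCLM, Submodule.starProjection_orthogonal_val, Submodule.starProjection_singleton,
    ← waveDot_eq_inner, norm_waveVec]
  simp only [proj, PiLp.sub_apply, PiLp.smul_apply, waveVec, smul_eq_mul,
    Real.sq_sqrt (waveSq_nonneg k), Complex.coe_algebraMap]
  ring

lemma mem_orthogonal_waveVec {k : Wave d} {z : Amp d} :
    z ∈ (ℂ ∙ waveVec k)ᗮ ↔ waveDot k z = 0 := by
  rw [Submodule.mem_orthogonal_singleton_iff_inner_right, waveDot_eq_inner]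

lemma waveDot_proj (k : Wave d) (z : Amp d) : waveDot k (proj k z) = 0 := by
  rw [← mem_orthogonal_waveVec, ← coe_projCLM]
  exact Submodule.starProjection_apply_mem _ z

lemma proj_eq_self {k : Wave d} {z : Amp d} (h : waveDot k z = 0) : proj k z = z := by
  rw [← coe_projCLM]
  exact Submodule.starProjection_eq_self_iff.2 (mem_orthogonal_waveVec.2 h)

lemma proj_smul_waveVec (k : Wave d) (c : ℂ) : proj k (c • waveVec k) = 0 := by
  rw [← coe_projCLM, map_smul, projCLM,
    Submodule.starProjection_orthogonalComplement_singleton_eq_zero, smul_zero]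

lemma norm_proj_le (k : Wave d) (z : Amp d) : ‖proj k z‖ ≤ ‖z‖ := by
  rw [← coe_projCLM]
  exact Submodule.norm_starProjection_apply_le _ z

lemma inner_proj_of_waveDot_eq_zero {k : Wave d} {y : Amp d} (h : waveDot k y = 0) (z : Amp d) :
    inner ℂ y (proj k z) = inner ℂ y z := by
  conv_rhs => rw [← proj_eq_self h]
  rw [← coe_projCLM]
  exact (Submodule.inner_starProjection_left_eq_right _ y z).symm

end Leray

section Reality

/-- Coordinatewise complex conjugation of amplitudes. -/
noncomputable def conjAmp : Amp d ≃ₗᵢ[ℝ] Amp d :=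
  LinearIsometryEquiv.piLpCongrRight 2 fun _ => Complex.conjLIE

lemma conjAmp_apply (z : Amp d) (i : Fin d) : conjAmp z i = starRingEnd ℂ (z i) := rfl

lemma conjAmp_smul (c : ℂ) (z : Amp d) : conjAmp (c • z) = starRingEnd ℂ c • conjAmp z := by
  ext i; simp [conjAmp_apply]

lemma inner_conjAmp_conjAmp (y z : Amp d) : inner ℂ (conjAmp y) (conjAmp z) = inner ℂ z y := by
  simp [PiLp.inner_apply, conjAmp_apply, mul_comm]

lemma waveDot_conjAmp (k : Wave d) (z : Amp d) :
    waveDot k (conjAmp z) = starRingEnd ℂ (waveDot k z) := by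
  simp [waveDot, conjAmp_apply]

lemma waveSq_neg (k : Wave d) : waveSq (-k) = waveSq k := by simp [waveSq]

lemma proj_neg_left (k : Wave d) (z : Amp d) : proj (-k) z = proj k z := by
  ext i
  simp [proj, waveDot_neg_left, waveSq_neg]

lemma proj_conjAmp (k : Wave d) (z : Amp d) : proj k (conjAmp z) = conjAmp (proj k z) := by
  ext i
  simp [proj, waveDot_conjAmp, conjAmp_apply]

/-- The conjugate reflection `k ↦ conj a_{-k}`; its fixed points are the Fourier coefficients of
real fields. -/
noncomputable def reflect (a : Wave d → Amp d) (k : Wave d) : Amp d := conjAmp (a (-k))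

/-- The reality condition `a_{-k} = conj a_k`, for the waves in `P`. -/
def IsRealOn (P : Finset (Wave d)) (a : Wave d → Amp d) : Prop := EqOn (reflect a) a P

/-- The transversality condition `k · a_k = 0`, for the waves in `P`. -/
def IsSolenoidalOn (P : Finset (Wave d)) (a : Wave d → Amp d) : Prop :=
  ∀ k ∈ P, waveDot k (a k) = 0

lemma IsRealOn.sub {P : Finset (Wave d)} {a b : Wave d → Amp d} (ha : IsRealOn P a)
    (hb : IsRealOn P b) : IsRealOn P (a - b) := fun k hk => by
  rw [reflect, Pi.sub_apply, map_sub, Pi.sub_apply]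
  exact congrArg₂ _ (ha hk) (hb hk)

lemma IsSolenoidalOn.sub {P : Finset (Wave d)} {a b : Wave d → Amp d} (ha : IsSolenoidalOn P a)
    (hb : IsSolenoidalOn P b) : IsSolenoidalOn P (a - b) := fun k hk => by
  rw [Pi.sub_apply, ← coe_waveDotCLM, map_sub, coe_waveDotCLM, ha k hk, hb k hk, sub_zero]

end Reality

section Interaction

/-- The `p`-th term of the series `-i ∑_p (k · a_p) A_k a_{k-p}` of quadratic interactions at the
wave vector `k`. -/
noncomputable def advectionTerm (a : Wave d → Amp d) (k p : Wave d) : Amp d :=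
  (-Complex.I) • waveDot k (a p) • proj k (a (k - p))

lemma interaction_congr {P Q : Finset (Wave d)} {a a' b b' : Wave d → Amp d} (ha : EqOn a a' P)
    (hb : EqOn b b' Q) : interaction P Q a b = interaction P Q a' b' := by
  ext1 k
  unfold interaction
  congr 1
  refine Finset.sum_congr rfl fun r hr => ?_
  obtain ⟨hP, hQ⟩ := Finset.mem_product.1 (Finset.mem_filter.1 hr).1
  rw [ha hP, hb hQ]

lemma interaction_smul_left (P Q : Finset (Wave d)) (c : ℂ) (a b : Wave d → Amp d) (k : Wave d) :
    interaction P Q (fun q => c • a q) b k = c • interaction P Q a b k := by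
  simp only [interaction, ← coe_waveDotCLM, map_smul, smul_assoc, ← Finset.smul_sum]
  rw [smul_comm]

lemma interaction_smul_right (P Q : Finset (Wave d)) (c : ℂ) (a b : Wave d → Amp d)
    (k : Wave d) : interaction P Q a (fun q => c • b q) k = c • interaction P Q a b k := by
  simp only [interaction, ← coe_projCLM, map_smul, smul_comm _ c, ← Finset.smul_sum]

lemma interaction_add_left (P Q : Finset (Wave d)) (a a' b : Wave d → Amp d) (k : Wave d) :
    interaction P Q (a + a') b k = interaction P Q a b k + interaction P Q a' b k := by
  simp only [interaction, Pi.add_apply, ← coe_waveDotCLM, map_add, add_smul,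
    Finset.sum_add_distrib, smul_add]

lemma interaction_add_right (P Q : Finset (Wave d)) (a b b' : Wave d → Amp d) (k : Wave d) :
    interaction P Q a (b + b') k = interaction P Q a b k + interaction P Q a b' k := by
  simp only [interaction, Pi.add_apply, ← coe_projCLM, map_add, smul_add,
    Finset.sum_add_distrib]

lemma waveDot_interaction (P Q : Finset (Wave d)) (a b : Wave d → Amp d) (k : Wave d) :
    waveDot k (interaction P Q a b k) = 0 := by
  have hproj : interaction P Q a b k =
      proj k ((-Complex.I) • ∑ r ∈ P ×ˢ Q with r.1 + r.2 = k, waveDot k (a r.1) • b r.2) := by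
    simp only [interaction, ← coe_projCLM, map_smul, map_sum]
  rw [hproj, waveDot_proj]

lemma interaction_zero_wave (P Q : Finset (Wave d)) (a b : Wave d → Amp d) :
    interaction P Q a b 0 = 0 := by
  simp [interaction, waveDot_zero_left]

lemma interaction_reflect {P Q : Finset (Wave d)} (hP : ∀ k ∈ P, -k ∈ P) (hQ : ∀ k ∈ Q, -k ∈ Q)
    (a b : Wave d → Amp d) :
    interaction P Q (reflect a) (reflect b) = reflect (interaction P Q a b) := by
  ext1 k
  have hneg (l : Wave d) (r : Wave d × Wave d) (hr : r ∈ {r ∈ P ×ˢ Q | r.1 + r.2 = l}) :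
      -r ∈ {r ∈ P ×ˢ Q | r.1 + r.2 = -l} := by
    simp only [Finset.mem_filter, Finset.mem_product] at hr ⊢
    exact ⟨⟨hP _ hr.1.1, hQ _ hr.1.2⟩, by simp only [← hr.2, Prod.fst_neg, Prod.snd_neg]; abel⟩
  simp only [reflect, interaction, conjAmp_smul, map_sum, map_neg, Complex.conj_I, neg_neg,
    Finset.smul_sum]
  refine Finset.sum_nbij' (fun r => -r) (fun r => -r) (hneg k)
    (fun r hr => neg_neg k ▸ hneg (-k) r hr) (fun r _ => neg_neg r) (fun r _ => neg_neg r)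
    fun r _ => ?_
  simp only [Prod.fst_neg, Prod.snd_neg, waveDot_conjAmp, proj_conjAmp, proj_neg_left,
    waveDot_neg_left, map_neg, neg_smul, smul_neg]

lemma isRealOn_interaction {P Q : Finset (Wave d)} (hP : ∀ k ∈ P, -k ∈ P) (hQ : ∀ k ∈ Q, -k ∈ Q)
    {a b : Wave d → Amp d} (ha : IsRealOn P a) (hb : IsRealOn Q b) (K : Finset (Wave d)) :
    IsRealOn K (interaction P Q a b) := fun k _ => by
  rw [← interaction_reflect hP hQ, interaction_congr ha hb]

lemma isSolenoidalOn_interaction (P Q K : Finset (Wave d)) (a b : Wave d → Amp d) :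
    IsSolenoidalOn K (interaction P Q a b) := fun k _ => waveDot_interaction P Q a b k

end Interaction

section RealFields

/-- `toAmp` as a real-linear isometry. -/
noncomputable def toAmpLI : Space d →ₗᵢ[ℝ] Amp d where
  toFun := toAmp
  map_add' y z := by ext i; simp [toAmp]
  map_smul' r y := by ext i; simp [toAmp]
  norm_map' y := by simp [toAmp, EuclideanSpace.norm_eq]

lemma coe_toAmpLI : ⇑(toAmpLI (d := d)) = toAmp := rfl

lemma continuous_toAmp : Continuous (toAmp (d := d)) := toAmpLI.continuous

lemma contDiff_toAmp : ContDiff ℝ 1 (toAmp (d := d)) := toAmpLI.contDiff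

lemma hasFDerivAt_toAmp_comp {f : Space d → Space d} (hf : ContDiff ℝ 1 f) (x : Space d) :
    HasFDerivAt (fun x => toAmp (f x)) (toAmpLI.toContinuousLinearMap.comp (fderiv ℝ f x)) x :=
  toAmpLI.toContinuousLinearMap.hasFDerivAt.comp x (hf.differentiable one_ne_zero x).hasFDerivAt

lemma hasFDerivAt_coord {f : Space d → Space d} (hf : ContDiff ℝ 1 f) (j : Fin d) (x : Space d) :
    HasFDerivAt (fun x => (f x j : ℂ))
      (Complex.ofRealCLM.comp ((EuclideanSpace.proj j).comp (fderiv ℝ f x))) x :=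
  Complex.ofRealCLM.hasFDerivAt.comp x
    ((EuclideanSpace.proj j : Space d →L[ℝ] ℝ).hasFDerivAt.comp x
      (hf.differentiable one_ne_zero x).hasFDerivAt)

lemma contDiff_coord {f : Space d → Space d} (hf : ContDiff ℝ 1 f) (j : Fin d) :
    ContDiff ℝ 1 fun x => (f x j : ℂ) :=
  Complex.ofRealCLM.contDiff.comp ((EuclideanSpace.proj j : Space d →L[ℝ] ℝ).contDiff.comp hf)

lemma fourierCoef_eq_coef (f : Space d → Space d) :
    fourierCoef f = coef fun x => toAmp (f x) := by
  ext1 k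
  simp [fourierCoef, coef, character, phase_neg]

lemma fourierCoef_apply {f : Space d → Space d} (hf : Continuous f) (k : Wave d) (j : Fin d) :
    fourierCoef f k j = coef (fun x => (f x j : ℂ)) k := by
  rw [fourierCoef_eq_coef]
  exact (coef_clm_comp (EuclideanSpace.proj j : Amp d →L[ℂ] ℂ) (continuous_toAmp.comp hf) k).symm

lemma reflect_fourierCoef (f : Space d → Space d) : reflect (fourierCoef f) = fourierCoef f := by
  ext1 k
  have hconj (x : Space d) : conjAmp (character (- -k) x • toAmp (f x)) =
      character (-k) x • toAmp (f x) := by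
    ext j
    simp [conjAmp, toAmp, character, phase_neg, ← Complex.exp_conj]
  rw [reflect, fourierCoef_eq_coef, coef, coef, map_smul, ← conjAmp.coe_toContinuousLinearEquiv,
    ← ContinuousLinearEquiv.integral_comp_comm]
  simp only [LinearIsometryEquiv.coe_toContinuousLinearEquiv, hconj]

end RealFields

section Incompressible

variable {f : Space d → Space d}

lemma waveDot_fourierCoef (hp : IsPeriodic f) (hf : ContDiff ℝ 1 f)
    (hdiv : ∀ x, divergence f x = 0) (k : Wave d) : waveDot k (fourierCoef f k) = 0 := by
  have hterm (j : Fin d) : Continuous fun x =>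
      fderiv ℝ (fun x => (f x j : ℂ)) x (EuclideanSpace.single j 1) :=
    ((contDiff_coord hf j).continuous_fderiv one_ne_zero).clm_apply continuous_const
  have hzero (x : Space d) :
      ∑ j, fderiv ℝ (fun x => (f x j : ℂ)) x (EuclideanSpace.single j 1) = 0 := by
    simp only [(hasFDerivAt_coord hf _ x).fderiv, ContinuousLinearMap.comp_apply,
      Complex.ofRealCLM_apply, PiLp.proj_apply]
    exact_mod_cast hdiv x
  have hsum := coef_sum Finset.univ (fun j _ => hterm j) k
  simp only [hzero, coef_fderiv (hp.comp fun y : Space d => (y _ : ℂ)) (contDiff_coord hf _),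
    ← fourierCoef_apply hf.continuous] at hsum
  have hcoef_zero : coef (fun _ : Space d => (0 : ℂ)) k = 0 := by simp [coef]
  rw [hcoef_zero] at hsum
  simpa [waveDot, mul_assoc, ← Finset.mul_sum] using hsum.symm

lemma toAmp_advection (hf : ContDiff ℝ 1 f) (hdiv : ∀ x, divergence f x = 0) (x : Space d) :
    toAmp (fderiv ℝ f x (f x)) =
      ∑ l, fderiv ℝ (fun x => (f x l : ℂ) • toAmp (f x)) x (EuclideanSpace.single l 1) := by
  have hbasis : f x = ∑ l, f x l • (EuclideanSpace.single l 1 : Space d) := by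
    ext i; simp [Pi.single_apply]
  have hdiv' : ∑ l, ((fderiv ℝ f x (EuclideanSpace.single l 1) l : ℝ) : ℂ) = 0 := by
    exact_mod_cast hdiv x
  have hleibniz (l : Fin d) :
      fderiv ℝ (fun x => (f x l : ℂ) • toAmp (f x)) x (EuclideanSpace.single l 1) =
        f x l • toAmp (fderiv ℝ f x (EuclideanSpace.single l 1)) +
          ((fderiv ℝ f x (EuclideanSpace.single l 1) l : ℝ) : ℂ) • toAmp (f x) := by
    rw [((hasFDerivAt_coord hf l x).fun_smul (hasFDerivAt_toAmp_comp hf x)).fderiv]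
    rfl
  conv_lhs => rw [hbasis]
  simp only [hleibniz, Finset.sum_add_distrib, ← Finset.sum_smul, hdiv', zero_smul, add_zero]
  simp only [map_sum, map_smul, ← coe_toAmpLI]

lemma hasSum_coef_advection (hp : IsPeriodic f) (hf : ContDiff ℝ 1 f)
    (hdiv : ∀ x, divergence f x = 0) (hs : Summable fun k => ‖fourierCoef f k‖) (k : Wave d) :
    HasSum (fun q => (Complex.I * waveDot k (fourierCoef f q)) • fourierCoef f (k - q))
      (coef (fun x => toAmp (fderiv ℝ f x (f x))) k) := by
  have hflux (l : Fin d) : ContDiff ℝ 1 fun x => (f x l : ℂ) • toAmp (f x) :=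
    (contDiff_coord hf l).smul (contDiff_toAmp.comp hf)
  have hterm (l : Fin d) : HasSum
      (fun q => (Complex.I * k l) • fourierCoef f q l • fourierCoef f (k - q))
      (coef (fun x => fderiv ℝ (fun x => (f x l : ℂ) • toAmp (f x)) x
        (EuclideanSpace.single l 1)) k) := by
    rw [coef_fderiv (hp.comp fun y => (y l : ℂ) • toAmp y) (hflux l)]
    have hcoord : Summable fun q => ‖coef (fun x => (f x l : ℂ)) q‖ := by
      refine hs.of_nonneg_of_le (fun _ => norm_nonneg _) fun q => ?_
      rw [← fourierCoef_apply hf.continuous]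
      exact PiLp.norm_apply_le _ _
    have hprod := hasSum_coef_smul (hp.comp fun y : Space d => (y l : ℂ))
      (contDiff_coord hf l).continuous hcoord (continuous_toAmp.comp hf.continuous) k
    simp only [← fourierCoef_apply hf.continuous, Function.comp_def, ← fourierCoef_eq_coef]
      at hprod
    exact hprod.const_smul _
  simp only [toAmp_advection hf hdiv]
  rw [coef_sum _ fun l _ => ((hflux l).continuous_fderiv one_ne_zero).clm_apply continuous_const]
  convert hasSum_sum (s := Finset.univ) fun l _ => hterm l using 2 with q
  simp only [smul_smul, ← Finset.sum_smul, waveDot, Finset.mul_sum, mul_assoc]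

end Incompressible

lemma continuous_gradient {q : Space d → ℝ} (hq : ContDiff ℝ 1 q) : Continuous (gradient q) :=
  (InnerProductSpace.toDual ℝ (Space d)).symm.continuous.comp (hq.continuous_fderiv one_ne_zero)

lemma coef_gradient {q : Space d → ℝ} (hp : IsPeriodic q) (hq : ContDiff ℝ 1 q) (k : Wave d) :
    coef (fun x => toAmp (gradient q x)) k =
      (Complex.I * coef (fun x => (q x : ℂ)) k) • waveVec k := by
  have hqc : ContDiff ℝ 1 fun x => (q x : ℂ) := Complex.ofRealCLM.contDiff.comp hq
  have hpartial (j : Fin d) (x : Space d) : toAmp (gradient q x) j =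
      fderiv ℝ (fun x => (q x : ℂ)) x (EuclideanSpace.single j 1) := by
    have hfd : HasFDerivAt (fun x => (q x : ℂ)) (Complex.ofRealCLM.comp (fderiv ℝ q x)) x :=
      Complex.ofRealCLM.hasFDerivAt.comp x (hq.differentiable one_ne_zero x).hasFDerivAt
    rw [hfd.fderiv, ContinuousLinearMap.comp_apply, ← inner_gradient_left,
      EuclideanSpace.inner_single_right]
    simp [toAmp]
  ext j
  have hj := coef_clm_comp (EuclideanSpace.proj j : Amp d →L[ℂ] ℂ)
    (continuous_toAmp.comp (continuous_gradient hq)) k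
  simp only [PiLp.proj_apply, Function.comp_apply, hpartial] at hj
  rw [coef_fderiv (hp.comp ((↑) : ℝ → ℂ)) hqc] at hj
  rw [← Function.comp_def toAmp, ← hj]
  simp [waveVec]
  ring

section Time

variable {E : Type*} [NormedAddCommGroup E] [NormedSpace ℂ E] {U V : ℝ → Space d → E}

lemma continuousOn_coef {K : Set ℝ} (hK : IsCompact K)
    (hU : ContinuousOn (fun z : ℝ × Space d => U z.1 z.2) (K ×ˢ univ)) (k : Wave d) :
    ContinuousOn (fun t => coef (U t) k) K := by
  obtain ⟨B, hB⟩ := (hK.prod (isCompact_cell d)).exists_bound_of_continuousOn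
    (hU.mono (prod_mono_right (subset_univ _)))
  refine ContinuousOn.fun_const_smul (continuousOn_of_dominated (bound := fun _ => B)
    (fun t ht => ?_) (fun t ht => ?_) (integrable_const _) (ae_of_all _ fun x => ?_)) _
  · refine (integrable_character_smul ?_ _).aestronglyMeasurable
    exact continuousOn_univ.1 (hU.comp (f := fun x => (t, x)) (by fun_prop)
      fun x _ => ⟨ht, trivial⟩)
  · refine (ae_restrict_mem (measurableSet_cell d)).mono fun x hx => ?_
    rw [norm_smul, norm_character, one_mul]
    exact hB (t, x) ⟨ht, hx⟩
  · exact continuousOn_const.smul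
      (hU.comp (f := fun t => (t, x)) (by fun_prop) fun t ht => ⟨ht, trivial⟩)

lemma hasDerivAt_coef {S : Set ℝ} (hS : IsOpen S) (hU : ∀ τ ∈ S, Continuous (U τ))
    (hV : ContinuousOn (fun z : ℝ × Space d => V z.1 z.2) (S ×ˢ univ))
    (hUV : ∀ τ ∈ S, ∀ x, HasDerivAt (fun τ => U τ x) (V τ x) τ) {t : ℝ} (ht : t ∈ S)
    (k : Wave d) : HasDerivAt (fun τ => coef (U τ) k) (coef (V t) k) t := by
  obtain ⟨ε, hε, hball⟩ := Metric.nhds_basis_closedBall.mem_iff.1 (hS.mem_nhds ht)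
  obtain ⟨B, hB⟩ :=
    ((isCompact_closedBall t ε).prod (isCompact_cell d)).exists_bound_of_continuousOn
      (hV.mono (prod_mono hball (subset_univ _)))
  have hslice : Continuous (V t) :=
    continuousOn_univ.1 (hV.comp (f := fun x => (t, x)) (by fun_prop) fun x _ => ⟨ht, trivial⟩)
  refine HasDerivAt.fun_const_smul _ (hasDerivAt_integral_of_dominated_loc_of_deriv_le
    (bound := fun _ => B) (F' := fun τ x => character (-k) x • V τ x)
    (Metric.closedBall_mem_nhds t hε) ?_ ?_ ?_ ?_ (integrable_const _) ?_).2
  · filter_upwards [hS.mem_nhds ht] with τ hτ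
    exact (integrable_character_smul (hU τ hτ) _).aestronglyMeasurable
  · exact integrable_character_smul (hU t ht) _
  · exact (integrable_character_smul hslice _).aestronglyMeasurable
  · refine (ae_restrict_mem (measurableSet_cell d)).mono fun x hx τ hτ => ?_
    rw [norm_smul, norm_character, one_mul]
    exact hB (τ, x) ⟨hτ, hx⟩
  · exact ae_of_all _ fun x τ hτ => (hUV τ (hball hτ) x).const_smul _

end Time

namespace IsEulerSolution

variable {T : ℝ} {u : ℝ → Space d → Space d} {p : ℝ → Space d → ℝ}

lemma contDiff_slice (h : IsEulerSolution T u p) {t : ℝ} (ht : t ∈ Icc 0 T) :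
    ContDiff ℝ 1 (u t) := by
  rw [← contDiffOn_univ]
  exact h.contDiffOn.comp (g := fun z : ℝ × Space d => u z.1 z.2) (f := fun x => (t, x))
    (contDiff_const.prodMk contDiff_id).contDiffOn (fun x _ => ⟨ht, mem_univ _⟩)

lemma waveDot_fourierCoef (h : IsEulerSolution T u p) {t : ℝ} (ht : t ∈ Icc 0 T) (k : Wave d) :
    waveDot k (fourierCoef (u t) k) = 0 :=
  TModelEuler.waveDot_fourierCoef (h.periodic t ht) (h.contDiff_slice ht) (h.incompressible t ht) k

lemma continuousOn_fourierCoef (h : IsEulerSolution T u p) (k : Wave d) :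
    ContinuousOn (fun t => fourierCoef (u t) k) (Icc 0 T) := by
  simp only [fourierCoef_eq_coef]
  exact continuousOn_coef isCompact_Icc
    (continuous_toAmp.comp_continuousOn h.contDiffOn.continuousOn) k

lemma hasDerivAt_fourierCoef (h : IsEulerSolution T u p) {t : ℝ} (ht : t ∈ Ioo 0 T)
    (k : Wave d) : HasDerivAt (fun τ => fourierCoef (u τ) k)
      (coef (fun x => toAmp (derivWithin (fun τ => u τ x) (Icc 0 T) t)) k) t := by
  let U (z : ℝ × Space d) : Space d := u z.1 z.2
  have hopen : IsOpen (Ioo 0 T ×ˢ (univ : Set (Space d))) := isOpen_Ioo.prod isOpen_univ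
  have hU : ContDiffOn ℝ 1 U (Ioo 0 T ×ˢ univ) :=
    h.contDiffOn.mono (prod_mono_left Ioo_subset_Icc_self)
  have hder (τ) (hτ : τ ∈ Ioo 0 T) (x) :
      HasDerivAt (fun τ => u τ x) (fderiv ℝ U (τ, x) (1, 0)) τ := by
    have hfd : HasFDerivAt U (fderiv ℝ U (τ, x)) (τ, x) :=
      ((hU.differentiableOn one_ne_zero).differentiableAt
        (hopen.mem_nhds ⟨hτ, mem_univ _⟩)).hasFDerivAt
    exact hfd.comp_hasDerivAt τ ((hasDerivAt_id τ).prodMk (hasDerivAt_const τ x))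
  have hderivWithin (x) : derivWithin (fun τ => u τ x) (Icc 0 T) t = fderiv ℝ U (t, x) (1, 0) :=
    (hder t ht x).hasDerivWithinAt.derivWithin
      (uniqueDiffOn_Icc (ht.1.trans ht.2) t (Ioo_subset_Icc_self ht))
  simp only [hderivWithin, fourierCoef_eq_coef]
  refine hasDerivAt_coef (V := fun τ x => toAmp (fderiv ℝ U (τ, x) (1, 0))) isOpen_Ioo
    (fun τ hτ => continuous_toAmp.comp (h.contDiff_slice (Ioo_subset_Icc_self hτ)).continuous)
    ?_ (fun τ hτ x => ?_) ht k
  · exact continuous_toAmp.comp_continuousOn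
      ((hU.continuousOn_fderiv_of_isOpen hopen le_rfl).clm_apply continuousOn_const)
  · exact toAmpLI.toContinuousLinearMap.hasFDerivAt.comp_hasDerivAt τ (hder τ hτ x)

lemma waveDot_deriv_fourierCoef (h : IsEulerSolution T u p) {t : ℝ} (ht : t ∈ Ioo 0 T)
    {k : Wave d} {D : Amp d} (hD : HasDerivAt (fun τ => fourierCoef (u τ) k) D t) :
    waveDot k D = 0 := by
  have hdot := ((waveDotCLM k).restrictScalars ℝ).hasFDerivAt.comp_hasDerivAt t hD
  have hconst : (fun τ => waveDotCLM k (fourierCoef (u τ) k)) =ᶠ[nhds t] fun _ => 0 := by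
    filter_upwards [isOpen_Ioo.mem_nhds ht] with τ hτ
    rw [coe_waveDotCLM, h.waveDot_fourierCoef (Ioo_subset_Icc_self hτ)]
  rw [← coe_waveDotCLM]
  exact hdot.unique ((hasDerivAt_const t (0 : ℂ)).congr_of_eventuallyEq hconst)

lemma proj_coef_derivWithin (h : IsEulerSolution T u p) {t : ℝ} (ht : t ∈ Icc 0 T) (k : Wave d) :
    proj k (coef (fun x => toAmp (derivWithin (fun τ => u τ x) (Icc 0 T) t)) k) =
      -proj k (coef (fun x => toAmp (fderiv ℝ (u t) x (u t x))) k) := by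
  have hu := h.contDiff_slice ht
  have hadv : Continuous fun x => toAmp (fderiv ℝ (u t) x (u t x)) :=
    continuous_toAmp.comp ((hu.continuous_fderiv one_ne_zero).clm_apply hu.continuous)
  have hgrad : Continuous fun x => toAmp (gradient (p t) x) :=
    continuous_toAmp.comp (continuous_gradient (h.contDiff_pressure t ht))
  have hmomentum (x) : toAmp (derivWithin (fun τ => u τ x) (Icc 0 T) t) =
      -toAmp (gradient (p t) x) - toAmp (fderiv ℝ (u t) x (u t x)) := by
    rw [eq_sub_of_add_eq (h.momentum t ht x), ← coe_toAmpLI, map_sub, map_neg]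
  have hneg (f : Space d → Amp d) : coef (fun x => -f x) k = -coef f k := by
    simp [coef, integral_neg]
  simp only [hmomentum]
  rw [coef_sub hgrad.fun_neg hadv, hneg,
    coef_gradient (h.periodic_pressure t ht) (h.contDiff_pressure t ht)]
  simp only [← coe_projCLM, map_sub, map_neg]
  rw [coe_projCLM, proj_smul_waveVec, neg_zero, zero_sub]

lemma exists_hasDerivAt_fourierCoef (h : IsEulerSolution T u p) {t : ℝ} (ht : t ∈ Ioo 0 T)
    (hs : Summable fun k => ‖fourierCoef (u t) k‖) (k : Wave d) :
    ∃ D, HasDerivAt (fun τ => fourierCoef (u τ) k) D t ∧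
      HasSum (advectionTerm (fourierCoef (u t)) k) D := by
  have ht' := Ioo_subset_Icc_self ht
  refine ⟨_, h.hasDerivAt_fourierCoef ht k, ?_⟩
  rw [← proj_eq_self (h.waveDot_deriv_fourierCoef ht (h.hasDerivAt_fourierCoef ht k)),
    h.proj_coef_derivWithin ht' k, ← coe_projCLM]
  have hadv := hasSum_coef_advection (h.periodic t ht') (h.contDiff_slice ht')
    (h.incompressible t ht') hs k
  refine (hadv.mapL (projCLM k)).neg.congr_fun fun q => ?_
  simp only [advectionTerm, coe_projCLM, map_smul, smul_smul, neg_mul, neg_smul]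

end IsEulerSolution

section AdvectionForm

/-- The `ℓ²` norm of the amplitudes of the waves in `P`. -/
noncomputable def l2On (P : Finset (Wave d)) (a : Wave d → Amp d) : ℝ := √(∑ k ∈ P, ‖a k‖ ^ 2)

lemma l2On_nonneg (P : Finset (Wave d)) (a : Wave d → Amp d) : 0 ≤ l2On P a := Real.sqrt_nonneg _

lemma sq_l2On (P : Finset (Wave d)) (a : Wave d → Amp d) :
    l2On P a ^ 2 = ∑ k ∈ P, ‖a k‖ ^ 2 := Real.sq_sqrt (by positivity)

lemma norm_sum_inner_le (P : Finset (Wave d)) (a b : Wave d → Amp d) :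
    ‖∑ k ∈ P, inner ℂ (a k) (b k)‖ ≤ l2On P a * l2On P b :=
  (norm_sum_le _ _).trans ((Finset.sum_le_sum fun _ _ => norm_inner_le_norm _ _).trans
    (Real.sum_mul_le_sqrt_mul_sqrt _ _ _))

/-- The trilinear form obtained by testing the interaction of `a` (waves in `P`) and `b` (waves in
`Q`) against `c` (waves in `K`). -/
noncomputable def advectionForm (P Q K : Finset (Wave d)) (a b c : Wave d → Amp d) : ℂ :=
  ∑ k ∈ K, inner ℂ (c k) (interaction P Q a b k)

variable {P Q K : Finset (Wave d)} {a b c : Wave d → Amp d}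

lemma advectionForm_add_left (P Q K : Finset (Wave d)) (a a' b c : Wave d → Amp d) :
    advectionForm P Q K (a + a') b c = advectionForm P Q K a b c + advectionForm P Q K a' b c := by
  simp only [advectionForm, interaction_add_left, inner_add_right, Finset.sum_add_distrib]

lemma advectionForm_add_mid (P Q K : Finset (Wave d)) (a b b' c : Wave d → Amp d) :
    advectionForm P Q K a (b + b') c = advectionForm P Q K a b c + advectionForm P Q K a b' c := by
  simp only [advectionForm, interaction_add_right, inner_add_right, Finset.sum_add_distrib]

/-- By transversality of `a` the derivative may be taken to fall on `b`, and by transversality of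
`c` the projection may be dropped. -/
lemma advectionForm_eq_sum (ha : IsSolenoidalOn P a) (hc : IsSolenoidalOn K c)
    (b : Wave d → Amp d) : advectionForm P Q K a b c = -Complex.I * ∑ p ∈ P, ∑ q ∈ Q, ∑ k ∈ K,
      if p + q = k then waveDot q (a p) * inner ℂ (c k) (b q) else 0 := by
  have hterm (k) (hk : k ∈ K) : inner ℂ (c k) (interaction P Q a b k) =
      -Complex.I * ∑ p ∈ P, ∑ q ∈ Q,
        if p + q = k then waveDot q (a p) * inner ℂ (c k) (b q) else 0 := by
    rw [interaction, inner_smul_right, inner_sum, Finset.sum_filter, Finset.sum_product]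
    congr 1
    refine Finset.sum_congr rfl fun p hp => Finset.sum_congr rfl fun q _ => ?_
    split_ifs with hpq
    · rw [inner_smul_right, inner_proj_of_waveDot_eq_zero (hc k hk), ← hpq, waveDot_add_left,
        ha p hp, zero_add]
    · rfl
  rw [advectionForm, Finset.sum_congr rfl hterm, ← Finset.mul_sum, Finset.sum_comm]
  exact congrArg _ (Finset.sum_congr rfl fun p _ => Finset.sum_comm)

lemma advectionForm_antisymm (hQ : ∀ k ∈ Q, -k ∈ Q) (hK : ∀ k ∈ K, -k ∈ K)
    (ha : IsSolenoidalOn P a) (hb : IsSolenoidalOn Q b) (hc : IsSolenoidalOn K c)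
    (hb' : IsRealOn Q b) (hc' : IsRealOn K c) :
    advectionForm P Q K a b c = -advectionForm P K Q a c b := by
  have sum_neg {S : Finset (Wave d)} (hS : ∀ k ∈ S, -k ∈ S) (f : Wave d → ℂ) :
      ∑ k ∈ S, f (-k) = ∑ k ∈ S, f k :=
    Finset.sum_nbij' (fun k => -k) (fun k => -k) hS hS (fun k _ => neg_neg k)
      (fun k _ => neg_neg k) fun _ _ => rfl
  have conj_eq {S : Finset (Wave d)} (hS : ∀ k ∈ S, -k ∈ S) {f : Wave d → Amp d}
      (hf : IsRealOn S f) {k : Wave d} (hk : k ∈ S) : f (-k) = conjAmp (f k) := by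
    rw [← hf (hS k hk), reflect, neg_neg]
  rw [advectionForm_eq_sum ha hc, advectionForm_eq_sum ha hb, ← mul_neg,
    ← Finset.sum_neg_distrib]
  refine congrArg _ (Finset.sum_congr rfl fun p hp => ?_)
  rw [Finset.sum_comm, ← sum_neg hK, ← Finset.sum_neg_distrib]
  refine Finset.sum_congr rfl fun k hk => ?_
  rw [← sum_neg hQ, ← Finset.sum_neg_distrib]
  refine Finset.sum_congr rfl fun q hq => ?_
  by_cases h : p + k = q
  · have hq_eq : p + -q = -k := by rw [← h]; abel
    rw [if_pos h, if_pos hq_eq, conj_eq hK hc' hk, conj_eq hQ hb' hq, inner_conjAmp_conjAmp,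
      waveDot_neg_left, ← h, waveDot_add_left, ha p hp, zero_add, neg_mul]
  · have hq_ne : ¬p + -q = -k := fun e => h (by rw [← neg_neg k, ← e]; abel)
    rw [if_neg h, if_neg hq_ne, neg_zero]

lemma advectionForm_self (hQ : ∀ k ∈ Q, -k ∈ Q) (ha : IsSolenoidalOn P a)
    (hb : IsSolenoidalOn Q b) (hb' : IsRealOn Q b) : advectionForm P Q Q a b b = 0 := by
  have h := advectionForm_antisymm hQ hQ ha hb hb hb' hb'
  linear_combination (1 / 2 : ℂ) * h

lemma sum_pairs_le_l2On (P K : Finset (Wave d)) (a c : Wave d → Amp d) (q : Wave d) :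
    ∑ p ∈ P, ∑ k ∈ K, (if p + q = k then ‖a p‖ * ‖c k‖ else 0) ≤ l2On P a * l2On K c := by
  rw [← Finset.sum_product', ← Finset.sum_filter]
  refine (Real.sum_mul_le_sqrt_mul_sqrt _ (fun r : Wave d × Wave d => ‖a r.1‖)
    (fun r => ‖c r.2‖)).trans ?_
  unfold l2On
  gcongr
  · rw [Finset.sum_filter, Finset.sum_product' P K fun p k => if p + q = k then ‖a p‖ ^ 2 else 0]
    refine Finset.sum_le_sum fun p _ => ?_
    rw [Finset.sum_ite_eq]
    split_ifs <;> first | exact le_rfl | positivity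
  · rw [Finset.sum_filter,
      Finset.sum_product_right' P K fun p k => if p + q = k then ‖c k‖ ^ 2 else 0]
    refine Finset.sum_le_sum fun k _ => ?_
    simp only [← eq_sub_iff_add_eq, Finset.sum_ite_eq']
    split_ifs <;> first | exact le_rfl | positivity

lemma norm_advectionForm_le (ha : IsSolenoidalOn P a) (hc : IsSolenoidalOn K c)
    (b : Wave d → Amp d) : ‖advectionForm P Q K a b c‖ ≤
      (∑ q ∈ Q, √(waveSq q) * ‖b q‖) * (l2On P a * l2On K c) := by
  rw [advectionForm_eq_sum ha hc, norm_mul, norm_neg, Complex.norm_I, one_mul, Finset.sum_comm,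
    Finset.sum_mul]
  refine (norm_sum_le _ _).trans (Finset.sum_le_sum fun q _ => ?_)
  refine le_trans ?_ (mul_le_mul_of_nonneg_left (sum_pairs_le_l2On P K a c q) (by positivity))
  simp only [Finset.mul_sum]
  refine (norm_sum_le _ _).trans (Finset.sum_le_sum fun p _ =>
    (norm_sum_le _ _).trans (Finset.sum_le_sum fun k _ => ?_))
  split_ifs
  · calc ‖waveDot q (a p) * inner ℂ (c k) (b q)‖
        ≤ (√(waveSq q) * ‖a p‖) * (‖c k‖ * ‖b q‖) := by
          rw [norm_mul]
          gcongr
          exacts [norm_waveDot_le _ _, norm_inner_le_norm _ _]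
      _ = √(waveSq q) * ‖b q‖ * (‖a p‖ * ‖c k‖) := by ring
  · simp

end AdvectionForm

section Energy

variable {F G : Finset (Wave d)} {v w : Wave d → Amp d}

lemma advectionForm_sub_right (hF : ∀ k ∈ F, -k ∈ F) {a : Wave d → Amp d}
    (ha : IsSolenoidalOn G a) (hv : IsSolenoidalOn F v) (hw : IsSolenoidalOn F w)
    (hv' : IsRealOn F v) (hw' : IsRealOn F w) :
    advectionForm G F F a v (w - v) = advectionForm G F F a w (w - v) := by
  conv_rhs => enter [5]; rw [← add_sub_cancel v w]
  rw [advectionForm_add_mid, advectionForm_self hF ha (hw.sub hv) (hw'.sub hv'), add_zero]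

lemma advectionForm_resolved_sub (hF : ∀ k ∈ F, -k ∈ F)
    (hv : IsSolenoidalOn F v) (hw : IsSolenoidalOn F w) (hv' : IsRealOn F v)
    (hw' : IsRealOn F w) :
    advectionForm F F F w w (w - v) - advectionForm F F F v v (w - v) =
      advectionForm F F F (w - v) w (w - v) := by
  rw [advectionForm_sub_right hF hv hv hw hv' hw', sub_eq_iff_eq_add', ← advectionForm_add_left,
    add_sub_cancel]

lemma advectionForm_memory (hF : ∀ k ∈ F, -k ∈ F) (hG : ∀ k ∈ G, -k ∈ G) {g : Wave d → Amp d}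
    (hg : IsSolenoidalOn G g) (hg' : IsRealOn G g) (hv : IsSolenoidalOn F v)
    (hw : IsSolenoidalOn F w) (hv' : IsRealOn F v) (hw' : IsRealOn F w) :
    advectionForm F G F v g (w - v) = advectionForm F F G v v g - advectionForm F F G w w g +
      advectionForm F F G (w - v) w g := by
  have hleft := advectionForm_add_left F F G v (w - v) w g
  have hmid := advectionForm_add_mid F F G v v (w - v) g
  rw [add_sub_cancel] at hleft hmid
  rw [advectionForm_antisymm hG hF hv hg (hw.sub hv) hg' (hw'.sub hv')]
  linear_combination hleft + hmid

/-- The memory term dissipates: with `g` the interaction of `v` with itself it contributes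
`-t ‖g‖²`, which absorbs every other occurrence of `g`. -/
lemma re_advectionForm_sub_le (hF : ∀ k ∈ F, -k ∈ F) (hG : ∀ k ∈ G, -k ∈ G)
    (hv : IsSolenoidalOn F v) (hw : IsSolenoidalOn F w) (hv' : IsRealOn F v) (hw' : IsRealOn F w)
    {t L x y H : ℝ} (ht : 0 ≤ t) (hL : ∑ q ∈ F, √(waveSq q) * ‖w q‖ ≤ L)
    (hx : l2On F (w - v) = x) (hy : l2On G (interaction F F v v) = y)
    (hH : l2On G (interaction F F w w) ≤ H) :
    (advectionForm F F F w w (w - v) - advectionForm F F F v v (w - v) -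
      t * (advectionForm F G F v (interaction F F v v) (w - v) +
        advectionForm G F F (interaction F F v v) v (w - v))).re ≤
      L * x ^ 2 + t * (H * y + 2 * (L * x * y) - y ^ 2) := by
  set g := interaction F F v v
  have hg : IsSolenoidalOn G g := isSolenoidalOn_interaction _ _ _ _ _
  have hg' : IsRealOn G g := isRealOn_interaction hF hF hv' hv' G
  have hx0 : 0 ≤ x := hx ▸ l2On_nonneg _ _
  have hy0 : 0 ≤ y := hy ▸ l2On_nonneg _ _
  have hdissipation : advectionForm F F G v v g = ((y ^ 2 : ℝ) : ℂ) := by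
    rw [← hy, sq_l2On, Complex.ofReal_sum]
    exact Finset.sum_congr rfl fun k _ => by
      rw [inner_self_eq_norm_sq_to_K, Complex.ofReal_pow]; rfl
  have hresolved : (advectionForm F F F (w - v) w (w - v)).re ≤ L * x ^ 2 := by
    refine (Complex.re_le_norm _).trans ((norm_advectionForm_le (hw.sub hv) (hw.sub hv) w).trans ?_)
    rw [hx, ← sq]
    gcongr
  have hforcing : (advectionForm F F G w w g).re ≤ H * y := by
    refine (Complex.re_le_norm _).trans ((norm_sum_inner_le _ _ _).trans ?_)
    rw [hy, mul_comm]
    gcongr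
  have hstretch : -(advectionForm F F G (w - v) w g).re ≤ L * x * y := by
    refine (neg_le_abs _).trans ((Complex.abs_re_le_norm _).trans
      ((norm_advectionForm_le (hw.sub hv) hg w).trans ?_))
    rw [hx, hy, mul_assoc]
    gcongr
  have hfeedback : -(advectionForm G F F g w (w - v)).re ≤ L * x * y := by
    refine (neg_le_abs _).trans ((Complex.abs_re_le_norm _).trans
      ((norm_advectionForm_le hg (hw.sub hv) w).trans ?_))
    rw [hx, hy, mul_assoc, mul_comm y]
    gcongr
  rw [advectionForm_resolved_sub hF hv hw hv' hw', advectionForm_memory hF hG hg hg' hv hw hv' hw',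
    advectionForm_sub_right hF hg hv hw hv' hw', hdissipation]
  simp only [Complex.sub_re, Complex.add_re, Complex.re_ofReal_mul, Complex.ofReal_re]
  nlinarith

lemma quadratic_absorption {t L H x y : ℝ} (ht : 0 ≤ t) :
    L * x ^ 2 + H * x + t * (H * y + 2 * (L * x * y) - y ^ 2) ≤
      (L + 2 * t * L ^ 2 + 1 / 2) * x ^ 2 + (t + 1) / 2 * H ^ 2 := by
  have hresidual := sq_nonneg (H - x)
  have hforcing := mul_nonneg ht (sq_nonneg (H - y))
  have hstretch := mul_nonneg ht (sq_nonneg (2 * L * x - y))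
  linarith

end Energy

section TModel

lemma mem_modes {n : ℕ} {k : Wave d} : k ∈ modes d n ↔ ∀ i, |k i| ≤ n := by
  simp [modes, Pi.le_def, abs_le, forall_and]

lemma neg_mem_modes {n : ℕ} {k : Wave d} (hk : k ∈ modes d n) : -k ∈ modes d n := by
  simpa [mem_modes] using hk

lemma neg_mem_unresolved {n m : ℕ} {k : Wave d} (hk : k ∈ unresolved d n m) :
    -k ∈ unresolved d n m := by
  simpa [unresolved, mem_modes] using hk

lemma tModelField_eq (n m : ℕ) (t : ℝ) (a : Wave d → Amp d) (k : Wave d) :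
    tModelField n m t a k = interaction (modes d n) (modes d n) a a k +
      (t : ℂ) • (interaction (modes d n) (unresolved d n m) a
          (interaction (modes d n) (modes d n) a a) k +
        interaction (unresolved d n m) (modes d n)
          (interaction (modes d n) (modes d n) a a) a k) := by
  simp only [tModelField, interaction_smul_left, interaction_smul_right, smul_add, add_assoc]

lemma sum_inner_tModelField (n m : ℕ) (t : ℝ) (a e : Wave d → Amp d) :
    ∑ k ∈ modes d n, inner ℂ (e k) (tModelField n m t a k) =
      advectionForm (modes d n) (modes d n) (modes d n) a a e +
        t * (advectionForm (modes d n) (unresolved d n m) (modes d n) a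
            (interaction (modes d n) (modes d n) a a) e +
          advectionForm (unresolved d n m) (modes d n) (modes d n)
            (interaction (modes d n) (modes d n) a a) a e) := by
  simp only [tModelField_eq, inner_add_right, inner_smul_right, Finset.sum_add_distrib,
    ← Finset.mul_sum, advectionForm]

lemma waveDot_tModelField (n m : ℕ) (t : ℝ) (a : Wave d → Amp d) (k : Wave d) :
    waveDot k (tModelField n m t a k) = 0 := by
  rw [tModelField_eq, ← coe_waveDotCLM, map_add, map_smul, map_add, coe_waveDotCLM]
  simp only [waveDot_interaction, add_zero, smul_zero]

lemma tModelField_zero_wave (n m : ℕ) (t : ℝ) (a : Wave d → Amp d) :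
    tModelField n m t a 0 = 0 := by
  simp only [tModelField_eq, interaction_zero_wave, add_zero, smul_zero]

lemma tModelField_congr (n m : ℕ) (t : ℝ) {a b : Wave d → Amp d} (h : EqOn a b (modes d n)) :
    tModelField n m t a = tModelField n m t b := by
  ext1 k
  have hg := interaction_congr h h
  rw [tModelField_eq, tModelField_eq, hg, interaction_congr h (fun _ _ => rfl),
    interaction_congr (fun _ _ => rfl) h]

lemma tModelField_reflect (n m : ℕ) (t : ℝ) (a : Wave d → Amp d) :
    tModelField n m t (reflect a) = reflect (tModelField n m t a) := by
  ext1 k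
  have hF (k) (hk : k ∈ modes d n) := neg_mem_modes hk
  have hG (k) (hk : k ∈ unresolved d n m) := neg_mem_unresolved hk
  rw [tModelField_eq, interaction_reflect hF hF, interaction_reflect hF hG,
    interaction_reflect hG hF]
  simp only [reflect, tModelField_eq, map_add, conjAmp_smul, Complex.conj_ofReal]

/-- The growth rate, at time `t`, of the squared error of the `t`-model against a field `w` with
`∑ |q| |w_q| ≤ L`. -/
noncomputable def growthRate (L t : ℝ) : ℝ := 2 * (L + 2 * t * L ^ 2 + 1 / 2)

lemma energy_estimate {n m : ℕ} {t : ℝ} (ht : 0 ≤ t) {v w R : Wave d → Amp d}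
    (hv : IsSolenoidalOn (modes d n) v) (hw : IsSolenoidalOn (modes d n) w)
    (hv' : IsRealOn (modes d n) v) (hw' : IsRealOn (modes d n) w)
    {L H : ℝ} (hL : ∑ q ∈ modes d n, √(waveSq q) * ‖w q‖ ≤ L) (hR : l2On (modes d n) R ≤ H)
    (hG : l2On (unresolved d n m) (interaction (modes d n) (modes d n) w w) ≤ H) :
    2 * (∑ k ∈ modes d n, inner ℂ ((w - v) k) (interaction (modes d n) (modes d n) w w k + R k -
      tModelField n m t v k)).re ≤
      growthRate L t * l2On (modes d n) (w - v) ^ 2 + (t + 1) * H ^ 2 := by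
  have hmain := re_advectionForm_sub_le (fun _ => neg_mem_modes)
    (fun _ => neg_mem_unresolved (n := n) (m := m)) hv hw hv' hw' ht hL rfl rfl hG
  have hresidual : (∑ k ∈ modes d n, inner ℂ ((w - v) k) (R k)).re ≤
      H * l2On (modes d n) (w - v) := by
    refine (Complex.re_le_norm _).trans ((norm_sum_inner_le _ _ _).trans ?_)
    rw [mul_comm]
    exact mul_le_mul_of_nonneg_right hR (l2On_nonneg _ _)
  have habsorb := quadratic_absorption (t := t) (L := L) (H := H)
    (x := l2On (modes d n) (w - v))
    (y := l2On (unresolved d n m) (interaction (modes d n) (modes d n) v v)) ht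
  simp only [inner_sub_right, inner_add_right, Finset.sum_sub_distrib, Finset.sum_add_distrib,
    sum_inner_tModelField]
  simp only [Complex.sub_re, Complex.add_re, advectionForm, growthRate] at hmain ⊢
  linarith

end TModel

section Evolution

lemma eqOn_Icc_of_hasDerivWithinAt {E : Type*} [NormedAddCommGroup E] [NormedSpace ℝ E]
    {Φ : ℝ × E → E} (hΦ : LocallyLipschitz Φ) {a b : ℝ} {f g : ℝ → E}
    (hf : ∀ t ∈ Icc a b, HasDerivWithinAt f (Φ (t, f t)) (Icc a b) t)
    (hg : ∀ t ∈ Icc a b, HasDerivWithinAt g (Φ (t, g t)) (Icc a b) t) (h : f a = g a) :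
    EqOn f g (Icc a b) := by
  have hfc : ContinuousOn f (Icc a b) := fun t ht => (hf t ht).continuousWithinAt
  have hgc : ContinuousOn g (Icc a b) := fun t ht => (hg t ht).continuousWithinAt
  have hright {y : ℝ → E} (hy : ∀ t ∈ Icc a b, HasDerivWithinAt y (Φ (t, y t)) (Icc a b) t)
      (t) (ht : t ∈ Ico a b) : HasDerivWithinAt y (Φ (t, y t)) (Ici t) t :=
    (hy t (Ico_subset_Icc_self ht)).mono_of_mem_nhdsWithin (Icc_mem_nhdsGE_of_mem ht)
  obtain ⟨K, hK⟩ := (hΦ.locallyLipschitzOn (s := Icc a b ×ˢ (f '' Icc a b ∪ g '' Icc a b))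
    ).exists_lipschitzOnWith_of_compact (isCompact_Icc.prod
      ((isCompact_Icc.image_of_continuousOn hfc).union (isCompact_Icc.image_of_continuousOn hgc)))
  refine ODE_solution_unique_of_mem_Icc_right (v := fun t y => Φ (t, y))
    (s := fun _ => f '' Icc a b ∪ g '' Icc a b) (K := K) (fun t ht y hy z hz => ?_)
    hfc (hright hf) (fun t ht => Or.inl (mem_image_of_mem _ (Ico_subset_Icc_self ht)))
    hgc (hright hg) (fun t ht => Or.inr (mem_image_of_mem _ (Ico_subset_Icc_self ht))) h
  simpa [Prod.edist_eq] using hK (x := (t, y)) ⟨Ico_subset_Icc_self ht, hy⟩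
    (y := (t, z)) ⟨Ico_subset_Icc_self ht, hz⟩

lemma contDiff_extend_subtypeVal {ι E : Type*} [NormedAddCommGroup E] [NormedSpace ℝ E]
    {r : WithTop ℕ∞} (P : Finset ι) (i : ι) :
    ContDiff ℝ r fun y : P → E => Function.extend Subtype.val y 0 i := by
  by_cases hi : i ∈ P
  · have heq (y : P → E) : Function.extend Subtype.val y 0 i = y ⟨i, hi⟩ :=
      Subtype.val_injective.extend_apply y 0 (⟨i, hi⟩ : P)
    simpa only [heq] using contDiff_apply ℝ E (⟨i, hi⟩ : P)
  · have hi' : ¬∃ j : P, j.1 = i := fun ⟨j, hj⟩ => hi (hj ▸ j.2)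
    simpa only [Function.extend_apply' _ _ _ hi'] using contDiff_const

variable {Z : Type*} [NormedAddCommGroup Z] [NormedSpace ℝ Z]

lemma contDiff_interaction {r : WithTop ℕ∞} (P Q : Finset (Wave d)) {a b : Z → Wave d → Amp d}
    (ha : ∀ k, ContDiff ℝ r fun z => a z k) (hb : ∀ k, ContDiff ℝ r fun z => b z k)
    (k : Wave d) : ContDiff ℝ r fun z => interaction P Q (a z) (b z) k := by
  simp only [interaction, ← coe_waveDotCLM, ← coe_projCLM]
  exact .const_smul _ (.sum fun q _ => .fun_smul
    (((waveDotCLM k).restrictScalars ℝ).contDiff.comp (ha q.1))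
    (((projCLM k).restrictScalars ℝ).contDiff.comp (hb q.2)))

lemma contDiff_tModelField {r : WithTop ℕ∞} (n m : ℕ) {τ : Z → ℝ} {a : Z → Wave d → Amp d}
    (hτ : ContDiff ℝ r τ) (ha : ∀ k, ContDiff ℝ r fun z => a z k) (k : Wave d) :
    ContDiff ℝ r fun z => tModelField n m (τ z) (a z) k := by
  simp only [tModelField_eq]
  have hF := contDiff_interaction (modes d n) (modes d n) ha ha
  exact (hF k).add ((Complex.ofRealCLM.contDiff.comp hτ).smul
    ((contDiff_interaction _ _ ha hF k).add (contDiff_interaction _ _ hF ha k)))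

end Evolution

namespace IsTModelSolution

variable {n m : ℕ} {T : ℝ} {a : Wave d → Amp d} {v : ℝ → Wave d → Amp d}

lemma hasDerivWithinAt (h : IsTModelSolution n m T a v) {t : ℝ} (ht : t ∈ Icc 0 T) {k : Wave d}
    (hk : k ∈ modes d n) :
    HasDerivWithinAt (fun τ => v τ k) (tModelField n m t (v t) k) (Icc 0 T) t := by
  rcases eq_or_ne k 0 with rfl | hk0
  · rw [tModelField_zero_wave]
    exact (hasDerivWithinAt_const t _ (0 : Amp d)).congr h.zero_mode (h.zero_mode t ht)
  · exact h.evolution t ht k hk hk0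

lemma isSolenoidalOn (h : IsTModelSolution n m T a v) (ha : IsSolenoidalOn (modes d n) a) {t : ℝ}
    (ht : t ∈ Icc 0 T) : IsSolenoidalOn (modes d n) (v t) := by
  intro k hk
  have hderiv (τ) (hτ : τ ∈ Icc 0 T) :
      HasDerivWithinAt (fun τ => waveDot k (v τ k)) 0 (Icc 0 T) τ := by
    rw [← waveDot_tModelField n m τ (v τ) k, ← coe_waveDotCLM]
    exact ((waveDotCLM k).restrictScalars ℝ).hasFDerivAt.comp_hasDerivWithinAt τ
      (h.hasDerivWithinAt hτ hk)
  rw [constant_of_has_deriv_right_zero (fun τ hτ => (hderiv τ hτ).continuousWithinAt)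
    (fun τ hτ => (hderiv τ (Ico_subset_Icc_self hτ)).mono_of_mem_nhdsWithin
      (Icc_mem_nhdsGE_of_mem hτ)) t ht, h.initial k hk, ha k hk]

lemma isRealOn (h : IsTModelSolution n m T a v) (ha : IsRealOn (modes d n) a) {t : ℝ}
    (ht : t ∈ Icc 0 T) : IsRealOn (modes d n) (v t) := by
  let extend (y : modes d n → Amp d) : Wave d → Amp d := Function.extend Subtype.val y 0
  let Φ (z : ℝ × (modes d n → Amp d)) (k : modes d n) : Amp d := tModelField n m z.1 (extend z.2) k
  have extend_restrict (w : Wave d → Amp d) : EqOn (extend fun k => w k) w (modes d n) :=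
    fun k hk => Subtype.val_injective.extend_apply _ _ (⟨k, hk⟩ : modes d n)
  have hΦ : ContDiff ℝ 1 Φ := contDiff_pi.2 fun k => contDiff_tModelField n m contDiff_fst
    (fun l => (contDiff_extend_subtypeVal (modes d n) l).comp contDiff_snd) k
  have hv (τ) (hτ : τ ∈ Icc 0 T) : HasDerivWithinAt (fun τ (k : modes d n) => v τ k)
      (Φ (τ, fun k => v τ k)) (Icc 0 T) τ := by
    refine hasDerivWithinAt_pi.2 fun k => ?_
    simp only [Φ, tModelField_congr n m τ (extend_restrict (v τ))]
    exact h.hasDerivWithinAt hτ k.2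
  have hv' (τ) (hτ : τ ∈ Icc 0 T) : HasDerivWithinAt (fun τ (k : modes d n) => reflect (v τ) k)
      (Φ (τ, fun k => reflect (v τ) k)) (Icc 0 T) τ := by
    refine hasDerivWithinAt_pi.2 fun k => ?_
    simp only [Φ, tModelField_congr n m τ (extend_restrict (reflect (v τ))), tModelField_reflect]
    exact conjAmp.toContinuousLinearEquiv.hasFDerivAt.comp_hasDerivWithinAt τ
      (h.hasDerivWithinAt hτ (neg_mem_modes k.2))
  refine fun k hk => congrFun (eqOn_Icc_of_hasDerivWithinAt hΦ.locallyLipschitz hv' hv ?_ ht)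
    (⟨k, hk⟩ : modes d n)
  ext1 l
  rw [reflect, h.initial _ (neg_mem_modes l.2), h.initial _ l.2]
  exact ha l.2

end IsTModelSolution

section Convolution

lemma sq_tsum_mul_le {ι : Type*} (x y : ι → ℝ≥0∞) :
    (∑' i, x i * y i) ^ 2 ≤ (∑' i, x i ^ 2) * ∑' i, y i ^ 2 := by
  let _ : MeasurableSpace ι := ⊤
  have hHolder := ENNReal.lintegral_mul_le_Lp_mul_Lq (Measure.count : Measure ι)
    Real.HolderConjugate.two_two (f := x) (g := y) measurable_from_top.aemeasurable
    measurable_from_top.aemeasurable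
  simp only [lintegral_count, Pi.mul_apply, ENNReal.rpow_two, one_div] at hHolder
  refine (pow_le_pow_left' hHolder 2).trans_eq ?_
  simp only [mul_pow, ← ENNReal.rpow_mul_natCast]
  norm_num

variable {A : Type*} [AddCommGroup A]

/-- The convolution of two nonnegative families over an additive group. -/
noncomputable def conv (x y : A → ℝ≥0∞) (k : A) : ℝ≥0∞ := ∑' p, x p * y (k - p)

lemma conv_comm (x y : A → ℝ≥0∞) : conv x y = conv y x := by
  ext1 k
  rw [conv, ← (Equiv.subLeft k).tsum_eq]
  simp only [Equiv.subLeft_apply, sub_sub_cancel, mul_comm, conv]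

lemma sq_conv_le (x y : A → ℝ≥0∞) (k : A) :
    conv x y k ^ 2 ≤ (∑' p, x p) * conv x (y ^ 2) k := by
  have sq_sqrt (z : ℝ≥0∞) : (z ^ (2⁻¹ : ℝ)) ^ 2 = z := by
    rw [← ENNReal.rpow_mul_natCast]; norm_num
  have hCS := sq_tsum_mul_le (fun p => x p ^ (2⁻¹ : ℝ)) fun p => x p ^ (2⁻¹ : ℝ) * y (k - p)
  simpa only [conv, Pi.pow_apply, mul_pow, sq_sqrt, ← mul_assoc, ← pow_two] using hCS

lemma tsum_sq_conv_le (x y : A → ℝ≥0∞) :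
    ∑' k, conv x y k ^ 2 ≤ (∑' p, x p) ^ 2 * ∑' q, y q ^ 2 := by
  calc ∑' k, conv x y k ^ 2
      ≤ ∑' k, (∑' p, x p) * conv x (y ^ 2) k := ENNReal.tsum_le_tsum (sq_conv_le x y)
    _ = (∑' p, x p) * ∑' p, x p * ∑' k, y (k - p) ^ 2 := by
        simp only [conv, ENNReal.tsum_mul_left, Pi.pow_apply]
        rw [ENNReal.tsum_comm]
        simp only [ENNReal.tsum_mul_left]
    _ = (∑' p, x p) ^ 2 * ∑' q, y q ^ 2 := by
        simp only [fun p => (Equiv.subRight p).tsum_eq fun q => y q ^ 2, ← Equiv.subRight_apply]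
        rw [ENNReal.tsum_mul_right, ← mul_assoc, pow_two]

end Convolution

section Weights

/-- The weighted amplitudes `(1+|k|²)^{s/2} |a_k|`. -/
noncomputable def weighted (s : ℝ) (a : Wave d → Amp d) (k : Wave d) : ℝ≥0∞ :=
  ENNReal.ofReal ((1 + waveSq k) ^ (s / 2)) * ‖a k‖ₑ

lemma one_add_waveSq_pos (k : Wave d) : 0 < 1 + waveSq k := by linarith [waveSq_nonneg k]

lemma sq_weighted (s : ℝ) (a : Wave d → Amp d) (k : Wave d) :
    weighted s a k ^ 2 = ENNReal.ofReal ((1 + waveSq k) ^ s) * ‖a k‖ₑ ^ 2 := by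
  have := one_add_waveSq_pos k
  rw [weighted, mul_pow, ← ENNReal.ofReal_pow (by positivity), ← Real.rpow_mul_natCast this.le]
  norm_num

lemma weighted_eq_mul (r s : ℝ) (a : Wave d → Amp d) (k : Wave d) :
    weighted r a k = ENNReal.ofReal ((1 + waveSq k) ^ ((r - s) / 2)) * weighted s a k := by
  have := one_add_waveSq_pos k
  rw [weighted, weighted, ← mul_assoc, ← ENNReal.ofReal_mul (by positivity), ← Real.rpow_add this]
  ring_nf

lemma weighted_mono {r s : ℝ} (hrs : r ≤ s) (a : Wave d → Amp d) (k : Wave d) :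
    weighted r a k ≤ weighted s a k := by
  unfold weighted
  gcongr
  linarith [waveSq_nonneg k]

lemma weighted_zero (a : Wave d → Amp d) (k : Wave d) : weighted 0 a k = ‖a k‖ₑ := by
  simp [weighted]

lemma ofReal_sqrt_waveSq_mul_norm_le (a : Wave d → Amp d) (k : Wave d) :
    ENNReal.ofReal (√(waveSq k) * ‖a k‖) ≤ weighted 1 a k := by
  rw [ENNReal.ofReal_mul (Real.sqrt_nonneg _), ofReal_norm, weighted, Real.sqrt_eq_rpow]
  gcongr
  · exact waveSq_nonneg k
  · linarith

/-- The weighted amplitudes `(1+|k|²)^{1/2} |a_k|` of the modes `|k|_∞ > N`. -/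
noncomputable def tail (N : ℕ) (a : Wave d → Amp d) : Wave d → ℝ≥0∞ :=
  (modes d N : Set (Wave d))ᶜ.indicator (weighted 1 a)

lemma tail_of_notMem {N : ℕ} {k : Wave d} (hk : k ∉ modes d N) (a : Wave d → Amp d) :
    tail N a k = weighted 1 a k := indicator_of_mem (s := (modes d N : Set (Wave d))ᶜ) hk _

lemma add_one_le_sqrt_waveSq {N : ℕ} {k : Wave d} (hk : k ∉ modes d N) :
    (N : ℝ) + 1 ≤ √(waveSq k) := by
  obtain ⟨i, hi⟩ : ∃ i, (N : ℤ) < |k i| := by simpa [mem_modes] using hk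
  calc (N : ℝ) + 1 ≤ |(k i : ℝ)| := by exact_mod_cast hi
    _ ≤ √(waveSq k) := Real.abs_le_sqrt (Finset.single_le_sum (f := fun i => (k i : ℝ) ^ 2)
        (fun _ _ => sq_nonneg _) (Finset.mem_univ i))

lemma tail_le (N : ℕ) {s : ℝ} (hs : 1 ≤ s) (a : Wave d → Amp d) (k : Wave d) :
    tail N a k ≤ ENNReal.ofReal (((N : ℝ) + 1) ^ (1 - s)) * weighted s a k := by
  by_cases hk : k ∈ modes d N
  · simp [tail, hk]
  rw [tail_of_notMem hk, weighted_eq_mul 1 s]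
  gcongr
  have hle : (N : ℝ) + 1 ≤ √(1 + waveSq k) :=
    (add_one_le_sqrt_waveSq hk).trans (Real.sqrt_le_sqrt (by linarith))
  calc (1 + waveSq k) ^ ((1 - s) / 2) = √(1 + waveSq k) ^ (1 - s) := by
        rw [Real.sqrt_eq_rpow, ← Real.rpow_mul (one_add_waveSq_pos k).le]; ring_nf
    _ ≤ ((N : ℝ) + 1) ^ (1 - s) :=
        Real.rpow_le_rpow_of_nonpos (by positivity) hle (by linarith)

lemma tsum_sq_tail_le (N : ℕ) {s : ℝ} (hs : 1 ≤ s) (a : Wave d → Amp d) :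
    ∑' k, tail N a k ^ 2 ≤
      ENNReal.ofReal (((N : ℝ) + 1) ^ (1 - s)) ^ 2 * ∑' k, weighted s a k ^ 2 := by
  rw [← ENNReal.tsum_mul_left]
  refine ENNReal.tsum_le_tsum fun k => ?_
  rw [← mul_pow]
  gcongr
  exact tail_le N hs a k

/-- The sum `∑_k (1+|k|²)^{-σ}`. -/
noncomputable def latticeSum (d : ℕ) (σ : ℝ) : ℝ≥0∞ :=
  ∑' k : Wave d, ENNReal.ofReal ((1 + waveSq k) ^ (-σ))

lemma summable_sqrt_waveSq_rpow {r : ℝ} (hr : r < -d) :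
    Summable fun k : Wave d => √(waveSq k) ^ r := by
  let b := (EuclideanSpace.basisFun (Fin d) ℝ).toBasis
  have hrank : Module.finrank ℤ (Submodule.span ℤ (range b)) = d := by
    rw [Module.finrank_eq_card_basis (b.restrictScalars ℤ), Fintype.card_fin]
  have hsum := ZLattice.summable_norm_rpow (Submodule.span ℤ (range b)) r (by rwa [hrank])
  refine ((b.restrictScalars ℤ).equivFun.symm.toEquiv.summable_iff.2 hsum).congr fun k => ?_
  have hb (i : Fin d) : b i = EuclideanSpace.single i 1 := by simp [b]
  simp [EuclideanSpace.norm_eq, waveSq, hb, Pi.single_apply]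

lemma latticeSum_lt_top {σ : ℝ} (hσ : (d : ℝ) / 2 < σ) : latticeSum d σ < ∞ := by
  have hsum := summable_sqrt_waveSq_rpow (d := d) (r := -(2 * σ)) (by linarith)
  refine Summable.tsum_ofReal_lt_top (hsum.of_norm_bounded_eventually ?_)
  refine (modes d 0).finite_toSet.subset fun k hk => ?_
  by_contra hk0
  have hpos : 0 < √(waveSq k) := by linarith [add_one_le_sqrt_waveSq (N := 0) hk0]
  refine hk ?_
  calc ‖(1 + waveSq k) ^ (-σ)‖ = (1 + waveSq k) ^ (-σ) :=
        Real.norm_of_nonneg (Real.rpow_nonneg (one_add_waveSq_pos k).le _)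
    _ ≤ waveSq k ^ (-σ) :=
        Real.rpow_le_rpow_of_nonpos (Real.sqrt_pos.1 hpos) (by linarith)
          (by linarith [d.cast_nonneg (α := ℝ)])
    _ = √(waveSq k) ^ (-(2 * σ)) := by
        rw [Real.sqrt_eq_rpow, ← Real.rpow_mul (waveSq_nonneg k)]; ring_nf

lemma sq_tsum_weighted_le (r s : ℝ) (a : Wave d → Amp d) :
    (∑' k, weighted r a k) ^ 2 ≤ latticeSum d (s - r) * ∑' k, weighted s a k ^ 2 := by
  have hCS := sq_tsum_mul_le (fun k : Wave d => ENNReal.ofReal ((1 + waveSq k) ^ ((r - s) / 2)))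
    (weighted s a)
  simp only [← weighted_eq_mul] at hCS
  refine hCS.trans_eq ?_
  congr 1
  refine tsum_congr fun k => ?_
  have := one_add_waveSq_pos k
  rw [← ENNReal.ofReal_pow (by positivity), ← Real.rpow_mul_natCast this.le]
  ring_nf

end Weights

section HighFrequencies

variable {a : Wave d → Amp d}

lemma enorm_advectionTerm_le (ha : ∀ k, waveDot k (a k) = 0) (k p : Wave d) :
    ‖advectionTerm a k p‖ₑ ≤ weighted 1 a p * weighted 1 a (k - p) := by
  have hdot : waveDot k (a p) = waveDot (k - p) (a p) := by
    conv_lhs => rw [← sub_add_cancel k p, waveDot_add_left, ha p, add_zero]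
  have hnorm : ‖advectionTerm a k p‖ ≤ ‖a p‖ * (√(waveSq (k - p)) * ‖a (k - p)‖) := by
    rw [advectionTerm, norm_smul, norm_smul, norm_neg, Complex.norm_I, one_mul, hdot,
      ← mul_assoc, mul_comm ‖a p‖]
    gcongr
    · exact norm_waveDot_le _ _
    · exact norm_proj_le _ _
  calc ‖advectionTerm a k p‖ₑ
      ≤ ‖a p‖ₑ * ENNReal.ofReal (√(waveSq (k - p)) * ‖a (k - p)‖) := by
        rw [← ofReal_norm, ← ofReal_norm, ← ENNReal.ofReal_mul (norm_nonneg _)]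
        exact ENNReal.ofReal_le_ofReal hnorm
    _ ≤ weighted 1 a p * weighted 1 a (k - p) := by
        gcongr
        · exact (weighted_zero a p).symm.trans_le (weighted_mono zero_le_one a p)
        · exact ofReal_sqrt_waveSq_mul_norm_le a (k - p)

lemma enorm_le_conv_tail (ha : ∀ k, waveDot k (a k) = 0) {N : ℕ} {k : Wave d} {S : Set (Wave d)}
    (hS : ∀ p ∈ S, p ∉ modes d N ∨ k - p ∉ modes d N) {X : Amp d}
    (hX : HasSum (S.indicator (advectionTerm a k)) X) :
    ‖X‖ₑ ≤ 2 * conv (weighted 1 a) (tail N a) k := by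
  have hterm (p : Wave d) : ‖S.indicator (advectionTerm a k) p‖ₑ ≤
      tail N a p * weighted 1 a (k - p) + weighted 1 a p * tail N a (k - p) := by
    by_cases hp : p ∈ S
    · rw [indicator_of_mem hp]
      refine (enorm_advectionTerm_le ha k p).trans ?_
      rcases hS p hp with hp | hp
      · exact le_add_right (by rw [tail_of_notMem hp])
      · exact le_add_left (by rw [tail_of_notMem hp])
    · simp [hp]
  calc ‖X‖ₑ ≤ ∑' p, ‖S.indicator (advectionTerm a k) p‖ₑ :=
        hX.tsum_eq ▸ enorm_tsum_le_tsum_enorm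
    _ ≤ conv (tail N a) (weighted 1 a) k + conv (weighted 1 a) (tail N a) k := by
        rw [conv, conv, ← ENNReal.tsum_add]
        exact ENNReal.tsum_le_tsum hterm
    _ = 2 * conv (weighted 1 a) (tail N a) k := by rw [conv_comm, two_mul]

lemma hasSum_interaction (F : Finset (Wave d)) (a : Wave d → Amp d) (k : Wave d) :
    HasSum ({p | p ∈ F ∧ k - p ∈ F}.indicator (advectionTerm a k)) (interaction F F a a k) := by
  have hsum : interaction F F a a k =
      ∑ p ∈ F, {p | p ∈ F ∧ k - p ∈ F}.indicator (advectionTerm a k) p := by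
    rw [interaction, Finset.smul_sum, Finset.sum_filter, Finset.sum_product]
    refine Finset.sum_congr rfl fun p hp => ?_
    simp only [← eq_sub_iff_add_eq', Finset.sum_ite_eq', indicator_apply, mem_ofPred_eq, hp,
      true_and, advectionTerm]
  rw [hsum]
  exact hasSum_sum_of_ne_finset_zero fun p hp => by simp [hp]

lemma modes_half_subset (n : ℕ) : modes d (n / 2) ⊆ modes d n := by
  intro k hk
  rw [mem_modes] at hk ⊢
  exact fun i => (hk i).trans (by omega)

lemma add_mem_modes_of_half {n : ℕ} {k l : Wave d} (hk : k ∈ modes d (n / 2))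
    (hl : l ∈ modes d (n / 2)) : k + l ∈ modes d n := by
  rw [mem_modes] at hk hl ⊢
  refine fun i => (abs_add_le _ _).trans ?_
  have := hk i
  have := hl i
  omega

lemma enorm_sub_interaction_le (n : ℕ) (ha : ∀ k, waveDot k (a k) = 0) {k : Wave d} {D : Amp d}
    (hD : HasSum (advectionTerm a k) D) :
    ‖D - interaction (modes d n) (modes d n) a a k‖ₑ ≤
      2 * conv (weighted 1 a) (tail (n / 2) a) k := by
  have hdiff := hD.sub (hasSum_interaction (modes d n) a k)
  simp only [← Pi.sub_apply, ← indicator_compl] at hdiff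
  refine enorm_le_conv_tail ha (fun p hp => ?_) hdiff
  by_contra! h
  exact hp ⟨modes_half_subset n h.1, modes_half_subset n h.2⟩

lemma enorm_interaction_le {n : ℕ} (ha : ∀ k, waveDot k (a k) = 0) {k : Wave d}
    (hk : k ∉ modes d n) :
    ‖interaction (modes d n) (modes d n) a a k‖ₑ ≤
      2 * conv (weighted 1 a) (tail (n / 2) a) k := by
  refine enorm_le_conv_tail ha (fun p _ => ?_) (hasSum_interaction (modes d n) a k)
  by_contra! h
  exact hk (add_sub_cancel p k ▸ add_mem_modes_of_half h.1 h.2)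

lemma sq_ofReal_l2On (P : Finset (Wave d)) (a : Wave d → Amp d) :
    ENNReal.ofReal (l2On P a) ^ 2 = ∑ k ∈ P, ‖a k‖ₑ ^ 2 := by
  rw [← ENNReal.ofReal_pow (l2On_nonneg P a), sq_l2On,
    ENNReal.ofReal_sum_of_nonneg fun _ _ => sq_nonneg _]
  simp only [ENNReal.ofReal_pow (norm_nonneg _), ofReal_norm]

lemma l2On_le_of_enorm_le_conv {P : Finset (Wave d)} {X : Wave d → Amp d} {x y : Wave d → ℝ≥0∞}
    (h : ∀ k ∈ P, ‖X k‖ₑ ≤ 2 * conv x y k) {L θ : ℝ} (hL₀ : 0 ≤ L) (hθ₀ : 0 ≤ θ)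
    (hL : ∑' k, x k ≤ ENNReal.ofReal L) (hθ : ∑' k, y k ^ 2 ≤ ENNReal.ofReal θ ^ 2) :
    l2On P X ≤ 2 * L * θ := by
  rw [← ENNReal.ofReal_le_ofReal_iff (by positivity), ← ENNReal.pow_le_pow_left_iff two_ne_zero,
    sq_ofReal_l2On]
  calc ∑ k ∈ P, ‖X k‖ₑ ^ 2 ≤ ∑ k ∈ P, (2 * conv x y k) ^ 2 :=
        Finset.sum_le_sum fun k hk => by gcongr; exact h k hk
    _ ≤ 2 ^ 2 * ∑' k, conv x y k ^ 2 := by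
        simp only [← ENNReal.tsum_mul_left, ← mul_pow]
        exact ENNReal.sum_le_tsum P
    _ ≤ 2 ^ 2 * (ENNReal.ofReal L ^ 2 * ENNReal.ofReal θ ^ 2) := by
        gcongr
        refine (tsum_sq_conv_le x y).trans ?_
        gcongr
    _ = ENNReal.ofReal (2 * L * θ) ^ 2 := by
        rw [ENNReal.ofReal_mul (by positivity), ENNReal.ofReal_mul zero_le_two,
          ENNReal.ofReal_ofNat, mul_pow, mul_pow, mul_assoc]

lemma sum_sqrt_waveSq_mul_norm_le (P : Finset (Wave d)) {L : ℝ} (hL₀ : 0 ≤ L)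
    (hL : ∑' k, weighted 1 a k ≤ ENNReal.ofReal L) : ∑ k ∈ P, √(waveSq k) * ‖a k‖ ≤ L := by
  rw [← ENNReal.ofReal_le_ofReal_iff hL₀, ENNReal.ofReal_sum_of_nonneg fun _ _ => by positivity]
  exact (Finset.sum_le_sum fun k _ => ofReal_sqrt_waveSq_mul_norm_le a k).trans
    ((ENNReal.sum_le_tsum P).trans hL)

lemma summable_norm_of_tsum_weighted_ne_top (h : ∑' k, weighted 1 a k ≠ ∞) :
    Summable fun k => ‖a k‖ := by
  refine summable_norm_iff.2 (Summable.of_enorm (ne_top_of_le_ne_top h ?_))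
  exact ENNReal.tsum_le_tsum fun k =>
    (weighted_zero a k).symm.trans_le (weighted_mono zero_le_one a k)

end HighFrequencies

section ResolvedError

lemma le_mul_exp_of_deriv_le {A B a b : ℝ} (hA : 0 ≤ A) (hB : 0 ≤ B) {E E' : ℝ → ℝ}
    (hE : ContinuousOn E (Icc a b)) (hE' : ∀ t ∈ Ioo a b, HasDerivAt E (E' t) t)
    (h : ∀ t ∈ Ioo a b, E' t ≤ A * E t + B) {t : ℝ} (ht : t ∈ Icc a b) :
    E t ≤ (E a + B * (t - a)) * Real.exp (A * (t - a)) := by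
  have hderiv : ∀ τ ∈ Ioo a b, HasDerivAt (fun τ => E τ * Real.exp (-A * (τ - a)) - B * τ)
      (E' τ * Real.exp (-A * (τ - a)) + E τ * (Real.exp (-A * (τ - a)) * (-A * 1)) - B * 1) τ :=
    fun τ hτ => ((hE' τ hτ).mul (((hasDerivAt_id τ).sub_const a).const_mul (-A)).exp).sub
      ((hasDerivAt_id τ).const_mul B)
  have hanti : AntitoneOn (fun τ => E τ * Real.exp (-A * (τ - a)) - B * τ) (Icc a b) := by
    refine antitoneOn_of_deriv_nonpos (convex_Icc a b) (by fun_prop) ?_ ?_ <;>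
      rw [interior_Icc]
    · exact fun τ hτ => (hderiv τ hτ).differentiableAt.differentiableWithinAt
    · intro τ hτ
      have hexp : Real.exp (-A * (τ - a)) ≤ 1 :=
        Real.exp_le_one_iff.2 (by nlinarith [hτ.1])
      rw [(hderiv τ hτ).deriv]
      nlinarith [mul_le_mul_of_nonneg_right (h τ hτ) (Real.exp_pos (-A * (τ - a))).le,
        mul_le_mul_of_nonneg_left hexp hB]
  have hle : E t * Real.exp (-A * (t - a)) ≤ E a + B * (t - a) := by
    have := hanti ⟨le_rfl, ht.1.trans ht.2⟩ ht ht.1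
    simp only [sub_self, mul_zero, Real.exp_zero, mul_one] at this
    linarith
  rw [neg_mul, Real.exp_neg, ← div_eq_mul_inv] at hle
  exact (div_le_iff₀ (Real.exp_pos _)).1 hle

lemma hasDerivAt_sq_l2On {P : Finset (Wave d)} {w : ℝ → Wave d → Amp d} {w' : Wave d → Amp d}
    {t : ℝ} (hw : ∀ k ∈ P, HasDerivAt (fun τ => w τ k) (w' k) t) :
    HasDerivAt (fun τ => l2On P (w τ) ^ 2) (2 * (∑ k ∈ P, inner ℂ (w t k) (w' k)).re) t := by
  have hinner (y z : Amp d) : inner ℝ y z = (inner ℂ y z).re := by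
    simp [PiLp.inner_apply, Complex.inner]
  simp only [sq_l2On, Complex.re_sum, Finset.mul_sum, ← hinner]
  exact HasDerivAt.fun_sum fun k hk => (hw k hk).norm_sq

lemma continuousOn_sq_l2On {P : Finset (Wave d)} {w : ℝ → Wave d → Amp d} {S : Set ℝ}
    (hw : ∀ k ∈ P, ContinuousOn (fun τ => w τ k) S) :
    ContinuousOn (fun τ => l2On P (w τ) ^ 2) S := by
  simp only [sq_l2On]
  exact continuousOn_finsetSum P fun k hk => (hw k hk).norm.pow 2

lemma growthRate_nonneg {L t : ℝ} (hL : 0 ≤ L) (ht : 0 ≤ t) : 0 ≤ growthRate L t := by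
  unfold growthRate
  positivity

lemma growthRate_mono {L t t' : ℝ} (h : t ≤ t') : growthRate L t ≤ growthRate L t' := by
  unfold growthRate
  gcongr

variable {T L θ : ℝ} {u : ℝ → Space d → Space d} {p : ℝ → Space d → ℝ} {n m : ℕ}
  {v : ℝ → Wave d → Amp d}

lemma exists_hasDerivAt_sq_resolved_error (hu : IsEulerSolution T u p)
    (hv : IsTModelSolution n m T (fourierCoef (u 0)) v) (hL₀ : 0 ≤ L) (hθ₀ : 0 ≤ θ) {t : ℝ}
    (ht : t ∈ Ioo 0 T) (hL : ∑' k, weighted 1 (fourierCoef (u t)) k ≤ ENNReal.ofReal L)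
    (hθ : ∑' k, tail (n / 2) (fourierCoef (u t)) k ^ 2 ≤ ENNReal.ofReal θ ^ 2) :
    ∃ E', HasDerivAt (fun τ => l2On (modes d n) (fourierCoef (u τ) - v τ) ^ 2) E' t ∧
      E' ≤ growthRate L t * l2On (modes d n) (fourierCoef (u t) - v t) ^ 2 +
        (t + 1) * (2 * L * θ) ^ 2 := by
  have htT : t ∈ Icc 0 T := Ioo_subset_Icc_self ht
  have h0 : (0 : ℝ) ∈ Icc 0 T := left_mem_Icc.2 (htT.1.trans htT.2)
  have hdiv := hu.waveDot_fourierCoef htT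
  have hreal (τ : ℝ) : IsRealOn (modes d n) (fourierCoef (u τ)) :=
    fun k _ => congrFun (reflect_fourierCoef (u τ)) k
  choose D hD hsum using hu.exists_hasDerivAt_fourierCoef ht
    (summable_norm_of_tsum_weighted_ne_top (ne_top_of_le_ne_top ENNReal.ofReal_ne_top hL))
  refine ⟨_, hasDerivAt_sq_l2On (w' := fun k => D k - tModelField n m t (v t) k) fun k hk =>
    (hD k).sub ((hv.hasDerivWithinAt htT hk).hasDerivAt (Icc_mem_nhds ht.1 ht.2)), ?_⟩
  have henergy := energy_estimate ht.1.le
    (R := D - interaction (modes d n) (modes d n) (fourierCoef (u t)) (fourierCoef (u t)))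
    (hv.isSolenoidalOn (fun k _ => hu.waveDot_fourierCoef h0 k) htT) (fun k _ => hdiv k)
    (hv.isRealOn (hreal 0) htT) (hreal t) (sum_sqrt_waveSq_mul_norm_le _ hL₀ hL)
    (l2On_le_of_enorm_le_conv (fun k _ => enorm_sub_interaction_le n hdiv (hsum k))
      hL₀ hθ₀ hL hθ)
    (l2On_le_of_enorm_le_conv (P := unresolved d n m) (fun k hk =>
      enorm_interaction_le hdiv (Finset.mem_sdiff.1 hk).2) hL₀ hθ₀ hL hθ)
  simpa only [Pi.sub_apply, add_sub_cancel] using henergy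

/-- The constant of the error estimate over a time `T`, for a solution with
`∑ (1 + |k|²)^{1/2} |u_k| ≤ L`. -/
noncomputable def errorConst (L T : ℝ) : ℝ :=
  (T + 1) * (2 * L) ^ 2 * T * Real.exp (growthRate L T * T) + 1

lemma errorConst_pos (L : ℝ) {T : ℝ} (hT : 0 ≤ T) : 0 < errorConst L T := by
  unfold errorConst
  positivity

lemma sq_resolved_error_le (hu : IsEulerSolution T u p)
    (hv : IsTModelSolution n m T (fourierCoef (u 0)) v) (hL₀ : 0 ≤ L) (hθ₀ : 0 ≤ θ)
    (hL : ∀ t ∈ Icc 0 T, ∑' k, weighted 1 (fourierCoef (u t)) k ≤ ENNReal.ofReal L)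
    (hθ : ∀ t ∈ Icc 0 T, ∑' k, tail (n / 2) (fourierCoef (u t)) k ^ 2 ≤ ENNReal.ofReal θ ^ 2)
    {t : ℝ} (ht : t ∈ Icc 0 T) :
    l2On (modes d n) (fourierCoef (u t) - v t) ^ 2 ≤ (errorConst L T - 1) * θ ^ 2 := by
  have hT : 0 ≤ T := ht.1.trans ht.2
  have hderiv : ∀ t ∈ Ioo 0 T, ∃ E',
      HasDerivAt (fun τ => l2On (modes d n) (fourierCoef (u τ) - v τ) ^ 2) E' t ∧
        E' ≤ growthRate L T * l2On (modes d n) (fourierCoef (u t) - v t) ^ 2 +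
          (T + 1) * (2 * L * θ) ^ 2 := fun t ht => by
    have htT : t ∈ Icc 0 T := Ioo_subset_Icc_self ht
    obtain ⟨E', hE', hle⟩ :=
      exists_hasDerivAt_sq_resolved_error hu hv hL₀ hθ₀ ht (hL t htT) (hθ t htT)
    refine ⟨E', hE', hle.trans ?_⟩
    gcongr
    · exact growthRate_mono htT.2
    · exact htT.2
  choose! E' hE' hle using hderiv
  have hcont : ContinuousOn (fun τ => l2On (modes d n) (fourierCoef (u τ) - v τ) ^ 2) (Icc 0 T) :=
    continuousOn_sq_l2On fun k hk => (hu.continuousOn_fourierCoef k).sub fun τ hτ =>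
      (hv.hasDerivWithinAt hτ hk).continuousWithinAt
  have hinit : l2On (modes d n) (fourierCoef (u 0) - v 0) ^ 2 = 0 := by
    rw [sq_l2On]
    exact Finset.sum_eq_zero fun k hk => by simp [hv.initial k hk]
  calc l2On (modes d n) (fourierCoef (u t) - v t) ^ 2
      ≤ (l2On (modes d n) (fourierCoef (u 0) - v 0) ^ 2 + (T + 1) * (2 * L * θ) ^ 2 * (t - 0)) *
          Real.exp (growthRate L T * (t - 0)) :=
        le_mul_exp_of_deriv_le (growthRate_nonneg hL₀ hT) (by positivity) hcont hE' hle ht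
    _ = (T + 1) * (2 * L * θ) ^ 2 * t * Real.exp (growthRate L T * t) := by
        rw [hinit, zero_add, sub_zero]
    _ ≤ (T + 1) * (2 * L * θ) ^ 2 * T * Real.exp (growthRate L T * T) := by
        have := growthRate_nonneg hL₀ hT
        gcongr <;> exact ht.2
    _ = (errorConst L T - 1) * θ ^ 2 := by
        rw [errorConst]
        ring

end ResolvedError

section Norms

lemma coef_trigPoly (n : ℕ) (a : Wave d → Amp d) :
    coef (trigPoly n a) = (modes d n : Set (Wave d)).indicator a := by
  ext1 k
  have hmode (l : Wave d) : coef (fun x => character l x • a l) k = if k = l then a l else 0 := by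
    simpa [coef_character, ite_smul] using
      coef_clm_comp (ContinuousLinearMap.toSpanSingleton ℂ (a l)) (continuous_character l) k
  have hcont (l : Wave d) : Continuous fun x => character l x • a l :=
    (continuous_character l).smul continuous_const
  change coef (fun x => ∑ l ∈ modes d n, character l x • a l) k = _
  simp only [coef_sum _ fun l _ => hcont l, hmode, Finset.sum_ite_eq, indicator_apply,
    Finset.mem_coe]

lemma isPeriodic_trigPoly (n : ℕ) (a : Wave d → Amp d) : IsPeriodic (trigPoly n a) := fun x j =>
  Finset.sum_congr rfl fun k _ => congrArg (· • a k) (isPeriodic_character k x j)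

lemma continuous_trigPoly (n : ℕ) (a : Wave d → Amp d) : Continuous (trigPoly n a) :=
  continuous_finsetSum _ fun k _ => (continuous_character k).smul continuous_const

lemma sq_l2Norm {w : Space d → Amp d} (hw : IsPeriodic w) (hc : Continuous w) :
    l2Norm w ^ 2 = ENNReal.ofReal ((2 * Real.pi) ^ d) * ∑' k, ‖coef w k‖ₑ ^ 2 := by
  have hmem : MemLp w 2 (volume.restrict (cell d)) :=
    (memLp_two_iff_integrable_sq_norm hc.aestronglyMeasurable).2
      (integrable_cell (hc.norm.pow 2))
  have hparseval := hasSum_norm_sq_coef_amp hw hc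
  have htsum : ∑' k, ‖coef w k‖ₑ ^ 2 =
      ENNReal.ofReal (((2 * Real.pi) ^ d)⁻¹ * ∫ x in cell d, ‖w x‖ ^ 2) := by
    rw [← hparseval.tsum_eq, ENNReal.ofReal_tsum_of_nonneg (fun _ => sq_nonneg _)
      hparseval.summable]
    simp only [ENNReal.ofReal_pow (norm_nonneg _), ofReal_norm]
  rw [htsum, ← ENNReal.ofReal_mul (by positivity), mul_inv_cancel_left₀ (by positivity), l2Norm,
    hmem.eLpNorm_eq_integral_rpow_norm two_ne_zero ENNReal.ofNat_ne_top,
    ← ENNReal.ofReal_pow (by positivity), ← Real.rpow_natCast, ← Real.rpow_mul (by positivity)]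
  simp

lemma sq_sobolevNorm (s : ℝ) (f : Space d → Space d) : sobolevNorm s f ^ 2 =
    ENNReal.ofReal ((2 * Real.pi) ^ d) * ∑' k, weighted s (fourierCoef f) k ^ 2 := by
  simp only [sobolevNorm, sq_weighted]
  rw [← ENNReal.rpow_natCast, ← ENNReal.rpow_mul]
  norm_num

lemma tsum_sq_weighted_le (s : ℝ) (f : Space d → Space d) :
    ∑' k, weighted s (fourierCoef f) k ^ 2 ≤ sobolevNorm s f ^ 2 := by
  rw [sq_sobolevNorm]
  refine le_mul_of_one_le_left zero_le (ENNReal.one_le_ofReal.2 (one_le_pow₀ ?_))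
  linarith [Real.pi_gt_three]

lemma exists_tsum_weighted_le {r : ℝ} (hr : (d : ℝ) / 2 + 1 < r) (M : ℝ) :
    ∃ L : ℝ, 0 ≤ L ∧ ∀ f : Space d → Space d, sobolevNorm r f ≤ ENNReal.ofReal M →
      ∑' k, weighted 1 (fourierCoef f) k ≤ ENNReal.ofReal L := by
  have hlattice : latticeSum d (r - 1) < ∞ := latticeSum_lt_top (by linarith)
  refine ⟨(latticeSum d (r - 1) ^ (1 / 2 : ℝ) * ENNReal.ofReal M).toReal, ENNReal.toReal_nonneg,
    fun f hf => ?_⟩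
  rw [ENNReal.ofReal_toReal (by finiteness), ← ENNReal.pow_le_pow_left_iff two_ne_zero, mul_pow,
    ← ENNReal.rpow_mul_natCast]
  rw [Nat.cast_ofNat, one_div_mul_cancel two_ne_zero, ENNReal.rpow_one]
  refine (sq_tsum_weighted_le 1 r _).trans ?_
  gcongr
  exact (tsum_sq_weighted_le r f).trans (by gcongr)

lemma coef_toAmp_sub_trigPoly {f : Space d → Space d} (hc : Continuous f) (n : ℕ)
    (a : Wave d → Amp d) : coef (fun x => toAmp (f x) - trigPoly n a x) =
      fourierCoef f - (modes d n : Set (Wave d)).indicator a := by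
  ext1 k
  rw [coef_sub (f := fun x => toAmp (f x)) (continuous_toAmp.comp hc) (continuous_trigPoly n a),
    coef_trigPoly, ← fourierCoef_eq_coef, Pi.sub_apply]

lemma tsum_sq_sub_indicator_modes_le (n : ℕ) (a b : Wave d → Amp d) :
    ∑' k, ‖(a - (modes d n : Set (Wave d)).indicator b) k‖ₑ ^ 2 ≤
      ENNReal.ofReal (l2On (modes d n) (a - b)) ^ 2 + ∑' k, tail (n / 2) a k ^ 2 := by
  have hterm (k : Wave d) : ‖(a - (modes d n : Set (Wave d)).indicator b) k‖ₑ ^ 2 ≤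
      (if k ∈ modes d n then ‖(a - b) k‖ₑ ^ 2 else 0) + tail (n / 2) a k ^ 2 := by
    by_cases hk : k ∈ modes d n
    · simp [hk]
    · rw [tail_of_notMem fun h => hk (modes_half_subset n h)]
      simpa [hk, weighted_zero] using
        pow_le_pow_left' (weighted_mono zero_le_one a k) 2
  refine (ENNReal.tsum_le_tsum hterm).trans_eq ?_
  rw [ENNReal.tsum_add, tsum_eq_sum fun k hk => if_neg hk, sq_ofReal_l2On]
  exact congrArg (· + _) (Finset.sum_congr rfl fun k hk => if_pos hk)

variable {T : ℝ} {u : ℝ → Space d → Space d} {p : ℝ → Space d → ℝ} {n m : ℕ}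
  {v : ℝ → Wave d → Amp d}

lemma l2Norm_error_le_of_tail_le {L θ : ℝ} (hu : IsEulerSolution T u p)
    (hv : IsTModelSolution n m T (fourierCoef (u 0)) v) (hL₀ : 0 ≤ L) (hθ₀ : 0 ≤ θ)
    (hL : ∀ t ∈ Icc 0 T, ∑' k, weighted 1 (fourierCoef (u t)) k ≤ ENNReal.ofReal L)
    (hθ : ∀ t ∈ Icc 0 T, ∑' k, tail (n / 2) (fourierCoef (u t)) k ^ 2 ≤ ENNReal.ofReal θ ^ 2)
    {t : ℝ} (ht : t ∈ Icc 0 T) :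
    l2Norm (fun x => toAmp (u t x) - trigPoly n (v t) x) ≤
      ENNReal.ofReal (√((2 * Real.pi) ^ d * errorConst L T) * θ) := by
  have hC : 0 ≤ (2 * Real.pi) ^ d * errorConst L T :=
    mul_nonneg (by positivity) (errorConst_pos L (ht.1.trans ht.2)).le
  have hc := (hu.contDiff_slice ht).continuous
  have hw : IsPeriodic fun x => toAmp (u t x) - trigPoly n (v t) x := fun x j => by
    simp only [hu.periodic t ht x j, isPeriodic_trigPoly n (v t) x j]
  rw [← ENNReal.pow_le_pow_left_iff two_ne_zero,
    sq_l2Norm hw ((continuous_toAmp.comp hc).sub (continuous_trigPoly n (v t))),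
    coef_toAmp_sub_trigPoly hc, ← ENNReal.ofReal_pow (by positivity),
    mul_pow _ θ, Real.sq_sqrt hC, mul_assoc, ENNReal.ofReal_mul (by positivity)]
  gcongr
  calc ∑' k, ‖(fourierCoef (u t) - (modes d n : Set (Wave d)).indicator (v t)) k‖ₑ ^ 2
      ≤ ENNReal.ofReal (l2On (modes d n) (fourierCoef (u t) - v t)) ^ 2 +
          ∑' k, tail (n / 2) (fourierCoef (u t)) k ^ 2 :=
        tsum_sq_sub_indicator_modes_le n _ _
    _ ≤ ENNReal.ofReal ((errorConst L T - 1) * θ ^ 2) + ENNReal.ofReal (θ ^ 2) := by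
        rw [← ENNReal.ofReal_pow (l2On_nonneg _ _), ENNReal.ofReal_pow hθ₀]
        gcongr
        · exact sq_resolved_error_le hu hv hL₀ hθ₀ hL hθ ht
        · exact hθ t ht
    _ = ENNReal.ofReal (errorConst L T * θ ^ 2) := by
        rw [← ENNReal.ofReal_add ?_ (sq_nonneg θ)]
        · congr 1
          ring
        · exact (sq_nonneg _).trans (sq_resolved_error_le hu hv hL₀ hθ₀ hL hθ ht)

lemma tsum_sq_tail_half_le {s K : ℝ} (hn : 1 ≤ n) (hs : 1 ≤ s)
    {f : Space d → Space d} (hK : sobolevNorm s f ≤ ENNReal.ofReal K) :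
    ∑' k, tail (n / 2) (fourierCoef f) k ^ 2 ≤
      ENNReal.ofReal (2 ^ (s - 1) / (n : ℝ) ^ (s - 1) * K) ^ 2 := by
  have hn₀ : (0 : ℝ) < n := by exact_mod_cast hn
  have hhalf : (n : ℝ) / 2 ≤ ((n / 2 : ℕ) : ℝ) + 1 := by
    have : (n : ℝ) ≤ 2 * (n / 2 : ℕ) + 2 := by exact_mod_cast (by omega : n ≤ 2 * (n / 2) + 2)
    linarith
  have hpow : (((n / 2 : ℕ) : ℝ) + 1) ^ (1 - s) ≤ 2 ^ (s - 1) / (n : ℝ) ^ (s - 1) :=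
    calc (((n / 2 : ℕ) : ℝ) + 1) ^ (1 - s) ≤ ((n : ℝ) / 2) ^ (1 - s) :=
          Real.rpow_le_rpow_of_nonpos (by positivity) hhalf (by linarith)
      _ = 2 ^ (s - 1) / (n : ℝ) ^ (s - 1) := by
          rw [← neg_sub s 1, Real.rpow_neg (by positivity), ← Real.inv_rpow (by positivity),
            inv_div, Real.div_rpow zero_le_two hn₀.le]
  rw [ENNReal.ofReal_mul (by positivity), mul_pow]
  refine (tsum_sq_tail_le (n / 2) hs _).trans ?_
  gcongr
  exact (tsum_sq_weighted_le s f).trans (by gcongr)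

end Norms

end TModelEuler

theorem mainTheorem2_general {d : ℕ} {r s : ℝ} (hr : (d : ℝ) / 2 + 1 < r) (hs : 1 ≤ s) (T M : ℝ) :
    ∃ C : ℝ, ∀ (u : ℝ → TModelEuler.Space d → TModelEuler.Space d)
      (p : ℝ → TModelEuler.Space d → ℝ),
      TModelEuler.IsEulerSolution T u p →
      (∀ t ∈ Set.Icc 0 T, TModelEuler.sobolevNorm r (u t) ≤ ENNReal.ofReal M) →
      ∀ (n m : ℕ), 1 ≤ n →
      ∀ v : ℝ → TModelEuler.Wave d → TModelEuler.Amp d,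
      TModelEuler.IsTModelSolution n m T (TModelEuler.fourierCoef (u 0)) v →
      ∀ t ∈ Set.Icc 0 T,
        TModelEuler.l2Norm
            (fun x => TModelEuler.toAmp (u t x) - TModelEuler.trigPoly n (v t) x) ≤
          ENNReal.ofReal (C / (n : ℝ) ^ (s - 1)) *
            ⨆ τ ∈ Set.Icc 0 T, TModelEuler.sobolevNorm s (u τ) := by
  obtain ⟨L, hL₀, hL⟩ := TModelEuler.exists_tsum_weighted_le hr M
  refine ⟨√((2 * Real.pi) ^ d * TModelEuler.errorConst L T) * 2 ^ (s - 1),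
    fun u p hu hM n m hn v hv t ht => ?_⟩
  have hC := TModelEuler.errorConst_pos L (ht.1.trans ht.2)
  set K := ⨆ τ ∈ Set.Icc 0 T, TModelEuler.sobolevNorm s (u τ)
  rcases eq_or_ne K ∞ with htop | hfin
  · rw [htop, ENNReal.mul_top (ENNReal.ofReal_pos.2 (div_pos (by positivity)
      (Real.rpow_pos_of_pos (Nat.cast_pos.2 hn) _))).ne']
    exact le_top
  have htail : ∀ τ ∈ Set.Icc 0 T,
      ∑' k, TModelEuler.tail (n / 2) (TModelEuler.fourierCoef (u τ)) k ^ 2 ≤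
        ENNReal.ofReal (2 ^ (s - 1) / (n : ℝ) ^ (s - 1) * K.toReal) ^ 2 := fun τ hτ =>
    TModelEuler.tsum_sq_tail_half_le hn hs <| by
      rw [ENNReal.ofReal_toReal hfin]
      exact le_iSup₂_of_le τ hτ le_rfl
  refine (TModelEuler.l2Norm_error_le_of_tail_le hu hv hL₀ (by positivity)
    (fun τ hτ => hL _ (hM τ hτ)) htail ht).trans_eq ?_
  rw [← mul_assoc, ← mul_div_assoc, ENNReal.ofReal_mul (by positivity), ENNReal.ofReal_toReal hfin]

theorem mainTheorem2 (d : ℕ) (hd : d = 2 ∨ d = 3) (s : ℝ) (hs : 3 ≤ s) (T : ℝ) (hT : 0 < T)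
    (M : ℝ) :
    ∃ C : ℝ, ∀ (u : ℝ → TModelEuler.Space d → TModelEuler.Space d)
      (p : ℝ → TModelEuler.Space d → ℝ),
      TModelEuler.IsEulerSolution T u p →
      (∀ t ∈ Set.Icc 0 T, TModelEuler.MemSobolev s (u t)) →
      (∀ t ∈ Set.Icc 0 T, TModelEuler.sobolevNorm 3 (u t) ≤ ENNReal.ofReal M) →
      ∀ (n m : ℕ), 1 ≤ n → n ≤ m →
      ∀ v : ℝ → TModelEuler.Wave d → TModelEuler.Amp d,
      TModelEuler.IsTModelSolution n m T (TModelEuler.fourierCoef (u 0)) v →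
      ∀ t ∈ Set.Icc 0 T,
        TModelEuler.l2Norm
            (fun x => TModelEuler.toAmp (u t x) - TModelEuler.trigPoly n (v t) x) ≤
          ENNReal.ofReal (C / (n : ℝ) ^ (s - 1)) *
            ⨆ τ ∈ Set.Icc 0 T, TModelEuler.sobolevNorm s (u τ) := by
  obtain ⟨C, hC⟩ := mainTheorem2_general (d := d) (r := 3)
    (by rcases hd with rfl | rfl <;> norm_num) (by linarith : 1 ≤ s) T M
  exact ⟨C, fun u p hu _ hM n m hn _ => hC u p hu hM n m hn⟩
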